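/- Conventions. All simplicial complexes are finite and contain the empty face; $K$ is a complex on a finite set $V$, $d=\dim K+1$, and $A=\mathbb{R}[x_v : v\in V]$ has the standard grading. The face ring is $\mathbb{R}[K]=A/I_K$, where $I_K$ is generated by the monomials whose support is not a face of $K$. A linear system of parameters (l.s.o.p.) of $K$ is a sequence $\Theta=(\theta_1,\dots,\theta_d)$ of linear forms in $A_1$ such that $\mathbb{R}[K]/(\Theta)$ is a finite-dimensional real vector space. For a family $\Theta$ of linear forms put $H(K,\Theta)=\mathbb{R}[K]/(\Theta)$, with its induced grading. For $0\le i\le d/2$, a linear form $\omega\in A_1$ is an $i$-Lefschetz element of $H(K,\Theta)$ if multiplication $\omega^{d-2i}: H(K,\Theta)_i\to H(K,\Theta)_{d-i}$ is an isomorphism; $H(K,\Theta)$ is $i$-Lefschetz if it has an $i$-Lefschetz element, and it is HL if a single $\omega$ is an $i$-Lefschetz element for all $0\le i\le d/2$. $H(K,\Theta)$ is unimodal WL if there is $\omega\in A_1$ such that multiplication $\omega: H(K,\Theta)_{i-1}\to H(K,\Theta)_i$ is injective for $1\le i\le\lceil d/2\rceil$ and surjective for $\lceil d/2\rceil<i\le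 d$. $K$ is Gorenstein$^*$ over $\mathbb{R}$ if it is pure and, for every face $F$ (including $\emptyset$), the link $\mathrm{lk}(F,K)$ has the reduced simplicial homology, with real coefficients, of a sphere of dimension $\dim \mathrm{lk}(F,K)$. (Every integral homology sphere has this property.) Statement. Let $S$ be a simplicial complex that is Gorenstein$^*$ over $\mathbb{R}$, with an l.s.o.p. $\Theta_S$, such that $H(S,\Theta_S)$ is $\lfloor(\dim S+1)/2\rfloor$-Lefschetz but not HL. Then there is a nonempty simplex $\sigma$, on vertices disjoint from those of $S$, such that the join $S*\partial\sigma$ with the boundary complex of $\sigma$ has even dimension $2j$ (with $j\ge 0$), and for every l.s.o.p. $\Theta_{\partial\sigma}$ of $\partial\sigma$: 1. the ring $\mathbb{R}[S*\partial\sigma]/(\Theta_S\cup\Theta_{\partial\sigma})$ has no $j$-Lefschetz element; 2. in particular, $H(S*\partial\sigma,\ \Theta_S\cup\Theta_{\partial\sigma})$ is not unimodal WL. -/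

import Mathlib

open MvPolynomial

noncomputable section

namespace PreAbstractSimplicialComplex

/-- Faces of the complex, with the empty set counted as a face. (Mathlib records only the nonempty
faces; the complex without nonempty faces is the `(-1)`-dimensional complex `{∅}`. Points of the
ground set that are not vertices are allowed and are harmless.) -/
def IsFace {V : Type*} (K : PreAbstractSimplicialComplex V) (F : Finset V) : Prop :=
  F = ∅ ∨ F ∈ K

/-- `dim K + 1`, the largest cardinality of a face of `K`. -/
def rank {V : Type*} [Fintype V] (K : PreAbstractSimplicialComplex V) : ℕ :=
  open Classical in (Finset.univ.filter fun F : Finset V => K.IsFace F).sup Finset.card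

/-- The dimension of `K`; it is `-1` for the complex `{∅}`. -/
def dim {V : Type*} [Fintype V] (K : PreAbstractSimplicialComplex V) : ℤ :=
  (K.rank : ℤ) - 1

/-- Every face lies in a face of the largest dimension. -/
def IsPure {V : Type*} [Fintype V] (K : PreAbstractSimplicialComplex V) : Prop :=
  ∀ F, K.IsFace F → ∃ G, K.IsFace G ∧ F ⊆ G ∧ G.card = K.rank

/-- The link of `F` in `K`. -/
def link {V : Type*} [DecidableEq V] (K : PreAbstractSimplicialComplex V) (F : Finset V) :
    PreAbstractSimplicialComplex V where
  faces := {G | G.Nonempty ∧ Disjoint G F ∧ G ∪ F ∈ K}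
  isRelLowerSet_faces := by
    rintro G ⟨hG, hd, hm⟩
    refine ⟨hG, fun G' hle hG' => ⟨hG', Finset.disjoint_of_subset_left hle hd, ?_⟩⟩
    exact (K.isRelLowerSet_faces hm).2 (Finset.union_subset_union_left hle)
      (hG'.mono Finset.subset_union_left)

/-- The join `K * L`, on the disjoint union of the two ground sets. -/
def join {V W : Type*} (K : PreAbstractSimplicialComplex V) (L : PreAbstractSimplicialComplex W) :
    PreAbstractSimplicialComplex (V ⊕ W) where
  faces := {F | F.Nonempty ∧ K.IsFace F.toLeft ∧ L.IsFace F.toRight}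
  isRelLowerSet_faces := by
    rintro F ⟨hF, hl, hr⟩
    refine ⟨hF, fun G hle hG => ⟨hG, ?_, ?_⟩⟩
    · rcases Finset.eq_empty_or_nonempty G.toLeft with h | h
      · exact Or.inl h
      · have hsub : G.toLeft ⊆ F.toLeft := fun x hx => by
          simp only [Finset.mem_toLeft] at hx ⊢; exact hle hx
        rcases hl with h0 | h1
        · exact absurd (h.mono hsub) (by simp [h0])
        · exact Or.inr ((K.isRelLowerSet_faces h1).2 hsub h)
    · rcases Finset.eq_empty_or_nonempty G.toRight with h | h
      · exact Or.inl h
      · have hsub : G.toRight ⊆ F.toRight := fun x hx => by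
          simp only [Finset.mem_toRight] at hx ⊢; exact hle hx
        rcases hr with h0 | h1
        · exact absurd (h.mono hsub) (by simp [h0])
        · exact Or.inr ((L.isRelLowerSet_faces h1).2 hsub h)

/-- The boundary complex of the simplex with vertex set `W` (for `W` nonempty): all proper
subsets of `W` are faces. -/
def simplexBoundary (W : Type*) [Fintype W] : PreAbstractSimplicialComplex W where
  faces := {F | F.Nonempty ∧ F ≠ Finset.univ}
  isRelLowerSet_faces := by
    rintro F ⟨hF, hne⟩
    refine ⟨hF, fun G hle hG => ⟨hG, fun h => hne ?_⟩⟩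
    exact Finset.univ_subset_iff.mp (h ▸ hle)

section Homology

variable {V : Type*} [Fintype V] [LinearOrder V] (k : Type*) [CommRing k]

/-- The simplicial boundary map on the free module on all subsets of `V`, realised as
`Finset V → k` with basis vectors `[F] = Pi.single F 1`:
`∂ [v₀ < ⋯ < vₘ] = ∑ᵢ (-1)ⁱ [v₀, …, v̂ᵢ, …, vₘ]`, and `∂ [∅] = 0`. -/
def boundaryMap : (Finset V → k) →ₗ[k] (Finset V → k) :=
  Fintype.linearCombination k fun F : Finset V =>
    ∑ v ∈ F, Pi.single (F.erase v) ((-1 : k) ^ (F.filter (· < v)).card)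

/-- Augmented simplicial chains: the span of the faces with `p` elements, i.e. of dimension
`p - 1`. -/
def chains (K : PreAbstractSimplicialComplex V) (p : ℕ) : Submodule k (Finset V → k) :=
  Submodule.span k ((fun F => Pi.single F 1) '' {F | K.IsFace F ∧ F.card = p})

/-- Reduced `(p-1)`-cycles. -/
def cycles (K : PreAbstractSimplicialComplex V) (p : ℕ) : Submodule k (Finset V → k) :=
  chains k K p ⊓ LinearMap.ker (boundaryMap k)

/-- Reduced `(p-1)`-boundaries. -/
def boundaries (K : PreAbstractSimplicialComplex V) (p : ℕ) : Submodule k (Finset V → k) :=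
  (chains k K (p + 1)).map (boundaryMap k)

/-- The reduced simplicial homology `H̃_{p-1}(K; k)`. -/
abbrev ReducedHomology (K : PreAbstractSimplicialComplex V) (p : ℕ) : Type _ :=
  ↥(cycles k K p) ⧸ (boundaries k K p).submoduleOf (cycles k K p)

/-- `K` has the reduced homology, with coefficients in `k`, of a sphere of dimension `dim K`. -/
def HasSphereHomology (K : PreAbstractSimplicialComplex V) : Prop :=
  (∀ p, p ≠ K.rank → Subsingleton (ReducedHomology k K p)) ∧
    Nonempty (ReducedHomology k K K.rank ≃ₗ[k] k)

/-- `K` is Gorenstein* over `k` (a `k`-homology sphere): it is pure, and the link of every face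
`F`, the empty one included, has the homology of a `dim (link F)`-sphere. -/
def IsGorensteinStar (K : PreAbstractSimplicialComplex V) : Prop :=
  K.IsPure ∧ ∀ F, K.IsFace F → (K.link F).HasSphereHomology k

end Homology

section FaceRing

variable {V : Type*} {ι : Type*}

/-- The Stanley–Reisner ideal `I_K`, generated by the monomials whose support is not a face. -/
def faceIdeal (K : PreAbstractSimplicialComplex V) : Ideal (MvPolynomial V ℝ) :=
  Ideal.span {p | ∃ s : V →₀ ℕ, ¬ K.IsFace s.support ∧ p = monomial s 1}

/-- The ideal `I_K + (Θ)` of the polynomial ring. -/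
def reductionIdeal (K : PreAbstractSimplicialComplex V) (Θ : ι → MvPolynomial V ℝ) :
    Ideal (MvPolynomial V ℝ) :=
  K.faceIdeal ⊔ Ideal.span (Set.range Θ)

/-- `H(K, Θ) = ℝ[K] / (Θ) = ℝ[x_v : v ∈ V] / (I_K + (Θ))`. -/
abbrev ReducedRing (K : PreAbstractSimplicialComplex V) (Θ : ι → MvPolynomial V ℝ) : Type _ :=
  MvPolynomial V ℝ ⧸ K.reductionIdeal Θ

/-- The degree `i` part `H(K, Θ)_i`, the image of the forms of degree `i`. -/
def gradedPart (K : PreAbstractSimplicialComplex V) (Θ : ι → MvPolynomial V ℝ) (i : ℕ) :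
    Submodule ℝ (K.ReducedRing Θ) :=
  (homogeneousSubmodule V ℝ i).map (Ideal.Quotient.mkₐ ℝ (K.reductionIdeal Θ)).toLinearMap

/-- Multiplication by the class of the polynomial `f` on `H(K, Θ)`. -/
def mulBy (K : PreAbstractSimplicialComplex V) (Θ : ι → MvPolynomial V ℝ)
    (f : MvPolynomial V ℝ) (x : K.ReducedRing Θ) : K.ReducedRing Θ :=
  Ideal.Quotient.mk (K.reductionIdeal Θ) f * x

variable [Fintype V]

/-- `Θ` is a linear system of parameters of `ℝ[K]`: `dim K + 1` linear forms such that
`ℝ[K] / (Θ)` is a finite-dimensional real vector space. -/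
def IsLSOP (K : PreAbstractSimplicialComplex V) (Θ : Fin K.rank → MvPolynomial V ℝ) : Prop :=
  (∀ a, (Θ a).IsHomogeneous 1) ∧ Module.Finite ℝ (K.ReducedRing Θ)

/-- With `d = dim K + 1` and `2 * i ≤ d`: the linear form `ω` is an `i`-Lefschetz element of
`H(K, Θ)`, i.e. `ω ^ (d - 2 * i) : H(K, Θ)_i → H(K, Θ)_{d - i}` is an isomorphism. -/
def IsLefschetzElement (K : PreAbstractSimplicialComplex V) (Θ : ι → MvPolynomial V ℝ) (i : ℕ)
    (ω : MvPolynomial V ℝ) : Prop :=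
  ω.IsHomogeneous 1 ∧
    Set.BijOn (K.mulBy Θ (ω ^ (K.rank - 2 * i))) (K.gradedPart Θ i) (K.gradedPart Θ (K.rank - i))

/-- `H(K, Θ)` is `i`-Lefschetz. -/
def IsLefschetz (K : PreAbstractSimplicialComplex V) (Θ : ι → MvPolynomial V ℝ) (i : ℕ) : Prop :=
  ∃ ω, K.IsLefschetzElement Θ i ω

/-- `H(K, Θ)` is HL: one linear form is an `i`-Lefschetz element for all `0 ≤ i ≤ d / 2`. -/
def IsHL (K : PreAbstractSimplicialComplex V) (Θ : ι → MvPolynomial V ℝ) : Prop :=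
  ∃ ω, ∀ i, 2 * i ≤ K.rank → K.IsLefschetzElement Θ i ω

/-- `H(K, Θ)` is unimodal weak-Lefschetz: for some linear form `ω`, multiplication
`ω : H(K, Θ)_{i-1} → H(K, Θ)_i` is injective for `1 ≤ i ≤ ⌈d/2⌉` and surjective for
`⌈d/2⌉ < i ≤ d`. -/
def IsUnimodalWL (K : PreAbstractSimplicialComplex V) (Θ : ι → MvPolynomial V ℝ) : Prop :=
  ∃ ω : MvPolynomial V ℝ, ω.IsHomogeneous 1 ∧
    (∀ i, 1 ≤ i → i ≤ (K.rank + 1) / 2 → Set.InjOn (K.mulBy Θ ω) (K.gradedPart Θ (i - 1))) ∧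
    (∀ i, (K.rank + 1) / 2 < i → i ≤ K.rank →
      Set.SurjOn (K.mulBy Θ ω) (K.gradedPart Θ (i - 1)) (K.gradedPart Θ i))

end FaceRing

/-- The union `Θ ∪ Θ'` of linear forms on two disjoint ground sets. -/
def unionForms {V W ι κ : Type*} (Θ : ι → MvPolynomial V ℝ) (Θ' : κ → MvPolynomial W ℝ) :
    ι ⊕ κ → MvPolynomial (V ⊕ W) ℝ :=
  Sum.elim (fun a => rename Sum.inl (Θ a)) (fun b => rename Sum.inr (Θ' b))

end PreAbstractSimplicialComplex

end

/-! Write `d` for the rank of `S` and `H` for its reduction. Failure of HL localizes to one degree.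
For fixed `i`, being an `i`-Lefschetz element is a nonzero polynomial condition on any line through
such an element, so if elements existed separately in all degrees they could be merged into one.
Hence there is `k` with `2k < d` and no `k`-Lefschetz element.

Let `σ` have `n = d - 2k` vertices. An l.s.o.p. of `∂σ` makes its variables nonzero multiples of a
single class `t`, and the reduction of `S * ∂σ` contains `H[t]/(t ^ n)`. The join has rank `2j + 1`
with `j = d - k - 1`, so both claims follow once no linear form is injective on degree `j`. Such a
form is `ω = η + γ t` with `η` linear on `S`. If `x` in `H_k` satisfies `η ^ n x = 0`, then `∑ (γ t)
^ a (-η) ^ (n-1-a) x` has degree `k + n - 1 = j`, and `ω` times it is `((γ t) ^ n - (-η) ^ n) x =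
0`. Injectivity of `ω` and the coefficient of `t ^ (n-1)` give `x = 0` when `γ ≠ 0`; when `γ = 0`
the monomials `η ^ (n-1-m) x t ^ m` do the same job. This is `eq_zero_of_injective_truncated`. So `η
^ (d-2k)` is injective on `H_k`.

To contradict the choice of `k`, injectivity must give bijectivity, which needs `dim H_k = dim
H_{d-k}`. Most of the file proves this symmetry. First, generic combinations of the l.s.o.p. form a
regular sequence on the face ring (`IsGorensteinStar.mem_of_linForm_mul_mem`): the face ring is
coresolved by the coordinate rings of its faces, and each multidegree of this complex computes the
homology of a link. The Hilbert series of `H` is therefore the h-polynomial. Second, the Euler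
characteristics of the links make the h-polynomial palindromic. -/

noncomputable section

namespace PreAbstractSimplicialComplex

set_option linter.unusedSectionVars false

/-! ### Ideals generated by linear forms, coordinate ideals of faces, and generic parameters -/

section LinearForms

variable {V : Type*} [Fintype V]

/-- The linear form with given coefficients. -/
def linForm : (V → ℝ) →ₗ[ℝ] MvPolynomial V ℝ :=
  Fintype.linearCombination ℝ (X : V → MvPolynomial V ℝ)

theorem linForm_apply (a : V → ℝ) : linForm a = ∑ v, a v • (X v : MvPolynomial V ℝ) := rfl

theorem coeff_linForm [DecidableEq V] (a : V → ℝ) (v : V) :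
    coeff (Finsupp.single v 1) (linForm a) = a v := by
  simp only [linForm_apply, coeff_sum, coeff_smul, coeff_X, smul_eq_mul,
    Finsupp.single_left_inj one_ne_zero]
  simp

theorem linForm_single [DecidableEq V] (v : V) :
    linForm (Pi.single v 1) = (X v : MvPolynomial V ℝ) := by
  simp [linForm_apply, Pi.single_apply, ite_smul]

theorem linForm_injective : Function.Injective (linForm (V := V)) := by
  classical
  intro a b h
  funext v
  rw [← coeff_linForm a v, h, coeff_linForm]

theorem isHomogeneous_linForm (a : V → ℝ) : (linForm a).IsHomogeneous 1 := by
  rw [linForm_apply]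
  refine IsHomogeneous.sum _ _ _ fun v _ => ?_
  rw [smul_eq_C_mul]
  exact isHomogeneous_C_mul_X _ _

theorem exists_linForm_eq {f : MvPolynomial V ℝ} (hf : f.IsHomogeneous 1) :
    ∃ a, linForm a = f := by
  have h : f ∈ homogeneousSubmodule V ℝ 1 := hf
  rw [homogeneousSubmodule_one_eq_span_X] at h
  have : Submodule.span ℝ (Set.range (X : V → MvPolynomial V ℝ)) = LinearMap.range linForm :=
    (Fintype.range_linearCombination ℝ (X : V → MvPolynomial V ℝ)).symm
  rw [this] at h
  exact h

/-- The ideal generated by a space of linear forms. -/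
def linIdeal (W : Submodule ℝ (V → ℝ)) : Ideal (MvPolynomial V ℝ) :=
  Ideal.span (linForm '' (W : Set (V → ℝ)))

theorem linForm_mem_linIdeal {W : Submodule ℝ (V → ℝ)} {a : V → ℝ} (ha : a ∈ W) :
    linForm a ∈ linIdeal W :=
  Ideal.subset_span ⟨a, ha, rfl⟩

theorem linIdeal_span (s : Set (V → ℝ)) :
    linIdeal (Submodule.span ℝ s) = Ideal.span (linForm '' s) := by
  apply le_antisymm
  · refine Ideal.span_le.2 ?_
    rintro _ ⟨a, ha, rfl⟩
    refine Submodule.span_induction (p := fun a _ => linForm a ∈ Ideal.span (linForm '' s))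
      ?_ ?_ ?_ ?_ ha
    · intro x hx; exact Ideal.subset_span ⟨x, hx, rfl⟩
    · simp
    · intro x y _ _ hx hy; rw [map_add]; exact add_mem hx hy
    · intro c x _ hx
      rw [map_smul, smul_eq_C_mul]; exact Ideal.mul_mem_left _ _ hx
  · exact Ideal.span_mono (Set.image_mono Submodule.subset_span)

theorem linIdeal_sup (W W' : Submodule ℝ (V → ℝ)) :
    linIdeal (W ⊔ W') = linIdeal W ⊔ linIdeal W' := by
  conv_lhs => rw [← Submodule.span_eq W, ← Submodule.span_eq W', ← Submodule.span_union]
  rw [linIdeal_span, Set.image_union, Ideal.span_union, linIdeal, linIdeal]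

/-- Project linear forms along a complement of `W` and extend the projection to an algebra
endomorphism. Its kernel is `linIdeal W` because the projection moves each variable only by an
element of `W`. The target being a domain is what later makes `linIdeal W` prime. -/
theorem exists_algHom_ker_eq_linIdeal (W : Submodule ℝ (V → ℝ)) :
    ∃ φ : MvPolynomial V ℝ →ₐ[ℝ] MvPolynomial V ℝ, RingHom.ker φ = linIdeal W ∧
      ∀ a, linForm a ∈ RingHom.ker φ → a ∈ W := by
  classical
  obtain ⟨U, hU⟩ := W.exists_isCompl
  let p : (V → ℝ) →ₗ[ℝ] (V → ℝ) := U.subtype ∘ₗ U.projectionOnto W hU.symm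
  have hp0 : ∀ a, p a = 0 ↔ a ∈ W := fun a => by
    simp [p]
  have hpW : ∀ a, a - p a ∈ W := fun a => by
    rw [← hp0, map_sub, sub_eq_zero]
    change ((U.projectionOnto W hU.symm a : U) : V → ℝ) =
      (U.projectionOnto W hU.symm ((U.projectionOnto W hU.symm a : U) : V → ℝ) : U)
    rw [Submodule.projectionOnto_apply_left]
  let φ : MvPolynomial V ℝ →ₐ[ℝ] MvPolynomial V ℝ := aeval fun v => linForm (p (Pi.single v 1))
  have hφ : ∀ a, φ (linForm a) = linForm (p a) := by
    intro a
    have : φ.toLinearMap ∘ₗ linForm = linForm ∘ₗ p := by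
      refine LinearMap.pi_ext' fun v => ?_
      ext
      simp [φ, linForm_single]
    exact LinearMap.congr_fun this a
  have hker : ∀ a, linForm a ∈ RingHom.ker φ → a ∈ W := by
    intro a ha
    rw [RingHom.mem_ker] at ha
    have h2 : linForm (p a) = 0 := (hφ a).symm.trans ha
    rw [← hp0]
    exact linForm_injective (by rw [h2, map_zero])
  refine ⟨φ, le_antisymm ?_ ?_, hker⟩
  · intro f hf
    have hf' : φ f = 0 := hf
    have key : ((Ideal.Quotient.mkₐ ℝ (linIdeal W)).comp φ) = Ideal.Quotient.mkₐ ℝ (linIdeal W) := by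
      apply MvPolynomial.algHom_ext
      intro v
      simp only [AlgHom.comp_apply, Ideal.Quotient.mkₐ_eq_mk, φ, aeval_X]
      rw [eq_comm, Ideal.Quotient.eq, ← linForm_single, ← map_sub]
      exact linForm_mem_linIdeal (hpW _)
    have := AlgHom.congr_fun key f
    simp only [AlgHom.comp_apply, hf', map_zero, Ideal.Quotient.mkₐ_eq_mk] at this
    exact Ideal.Quotient.eq_zero_iff_mem.1 this.symm
  · refine Ideal.span_le.2 ?_
    rintro _ ⟨a, ha, rfl⟩
    change φ (linForm a) = 0
    rw [hφ, (hp0 a).2 ha, map_zero]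

theorem linIdeal_isPrime (W : Submodule ℝ (V → ℝ)) : (linIdeal W).IsPrime := by
  obtain ⟨φ, h, -⟩ := exists_algHom_ker_eq_linIdeal W
  rw [← h]
  exact RingHom.ker_isPrime _

theorem linForm_mem_linIdeal_iff {W : Submodule ℝ (V → ℝ)} {a : V → ℝ} :
    linForm a ∈ linIdeal W ↔ a ∈ W := by
  refine ⟨fun ha => ?_, linForm_mem_linIdeal⟩
  obtain ⟨φ, h, h'⟩ := exists_algHom_ker_eq_linIdeal W
  exact h' a (h ▸ ha)

theorem mem_linIdeal_of_linForm_mul_mem {W : Submodule ℝ (V → ℝ)} {a : V → ℝ} (ha : a ∉ W)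
    {f : MvPolynomial V ℝ} (h : linForm a * f ∈ linIdeal W) : f ∈ linIdeal W :=
  ((linIdeal_isPrime W).mem_or_mem h).resolve_left fun h' => ha (linForm_mem_linIdeal_iff.1 h')

theorem constantCoeff_eq_zero_of_mem_linIdeal {W : Submodule ℝ (V → ℝ)} {f : MvPolynomial V ℝ}
    (hf : f ∈ linIdeal W) : constantCoeff f = 0 := by
  have : linIdeal W ≤ RingHom.ker (constantCoeff (R := ℝ) (σ := V)) := by
    refine Ideal.span_le.2 ?_
    rintro _ ⟨a, -, rfl⟩
    change constantCoeff (linForm a) = 0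
    simp [linForm_apply]
  exact this hf

/-- A linear form outside `W` would be a nonzero element of a finite-dimensional domain, hence
invertible. But modulo an ideal without constant terms a linear form cannot divide `1`. -/
theorem eq_top_of_finite_quotient_linIdeal {W : Submodule ℝ (V → ℝ)}
    (h : Module.Finite ℝ (MvPolynomial V ℝ ⧸ linIdeal W)) : W = ⊤ := by
  rw [eq_top_iff]
  intro a _
  by_contra ha
  let q := Ideal.Quotient.mk (linIdeal W)
  have hp := linIdeal_isPrime W
  have hinj : Function.Injective (LinearMap.mulLeft ℝ (q (linForm a))) := by
    rw [← LinearMap.ker_eq_bot, LinearMap.ker_eq_bot']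
    intro m hm
    have hm' : q (linForm a) * m = 0 := hm
    rcases mul_eq_zero.1 hm' with h0 | h0
    · exact absurd (linForm_mem_linIdeal_iff.1 (Ideal.Quotient.eq_zero_iff_mem.1 h0)) ha
    · exact h0
  obtain ⟨y, hy⟩ := (LinearMap.injective_iff_surjective.1 hinj) 1
  obtain ⟨g, rfl⟩ := Ideal.Quotient.mk_surjective y
  have hy' : q (linForm a * g) = q 1 := by rw [map_mul, map_one]; exact hy
  have h1 := constantCoeff_eq_zero_of_mem_linIdeal (Ideal.Quotient.eq.1 hy')
  have h2 : constantCoeff (linForm a) = 0 := by simp [linForm_apply]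
  simp [h2] at h1

/-- The coefficient vectors that vanish on `F`. -/
def vanishing (F : Finset V) : Submodule ℝ (V → ℝ) where
  carrier := {a | ∀ v ∈ F, a v = 0}
  add_mem' := fun ha hb v hv => by simp [ha v hv, hb v hv]
  zero_mem' := fun _ _ => rfl
  smul_mem' := fun c a ha v hv => by simp [ha v hv]

theorem mem_vanishing {F : Finset V} {a : V → ℝ} : a ∈ vanishing F ↔ ∀ v ∈ F, a v = 0 := Iff.rfl

theorem vanishing_eq_span [DecidableEq V] (F : Finset V) :
    vanishing F = Submodule.span ℝ ((fun v => Pi.single v (1 : ℝ)) '' {v | v ∉ F}) := by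
  apply le_antisymm
  · intro a ha
    rw [pi_eq_sum_univ' a]
    refine Submodule.sum_mem _ fun v _ => ?_
    by_cases hv : v ∈ F
    · simp [ha v hv]
    · refine Submodule.smul_mem _ _ (Submodule.subset_span ⟨v, hv, ?_⟩)
      ext i; simp [Pi.single_apply, eq_comm]
  · refine Submodule.span_le.2 ?_
    rintro _ ⟨v, hv, rfl⟩ w hw
    have : w ≠ v := fun h => hv (h ▸ hw)
    simp [this]

theorem finrank_vanishing (F : Finset V) :
    Module.finrank ℝ (vanishing F) + F.card = Fintype.card V := by
  classical
  let r : (V → ℝ) →ₗ[ℝ] (F → ℝ) := LinearMap.funLeft ℝ ℝ (Subtype.val : F → V)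
  have hk : LinearMap.ker r = vanishing F := by
    ext a
    simp [r, mem_vanishing, funext_iff, LinearMap.funLeft_apply]
  have hs : Function.Surjective r :=
    LinearMap.funLeft_surjective_of_injective _ _ _ Subtype.val_injective
  have := LinearMap.finrank_range_add_finrank_ker r
  rw [LinearMap.range_eq_top.2 hs, finrank_top, hk] at this
  simp at this
  omega

/-- The ideal generated by the variables outside `F`. -/
abbrev coordIdeal (F : Finset V) : Ideal (MvPolynomial V ℝ) := linIdeal (vanishing F)

theorem mem_coordIdeal_iff {F : Finset V} {f : MvPolynomial V ℝ} :
    f ∈ coordIdeal F ↔ ∀ s : V →₀ ℕ, s.support ⊆ F → coeff s f = 0 := by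
  classical
  have : coordIdeal F = Ideal.span ((X : V → MvPolynomial V ℝ) '' {v | v ∉ F}) := by
    rw [coordIdeal, vanishing_eq_span, linIdeal_span, Set.image_image]
    simp [linForm_single]
  rw [this, mem_ideal_span_X_image]
  constructor
  · intro h s hs
    by_contra hc
    obtain ⟨i, hi, hsi⟩ := h s (mem_support_iff.2 hc)
    exact hi (hs (Finsupp.mem_support_iff.2 hsi))
  · intro h m hm
    by_contra! hc
    refine mem_support_iff.1 hm (h m fun v hv => ?_)
    by_contra hvF
    exact (Finsupp.mem_support_iff.1 hv) (hc v hvF)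

theorem IsFace.subset {K : PreAbstractSimplicialComplex V} {F G : Finset V} (hF : K.IsFace F)
    (hGF : G ⊆ F) : K.IsFace G := by
  rcases Finset.eq_empty_or_nonempty G with h | h
  · exact Or.inl h
  · rcases hF with rfl | hF
    · exact Or.inl (Finset.subset_empty.1 hGF)
    · exact Or.inr ((K.isRelLowerSet_faces hF).2 hGF h)

theorem mem_faceIdeal_iff (K : PreAbstractSimplicialComplex V) {f : MvPolynomial V ℝ} :
    f ∈ K.faceIdeal ↔ ∀ s : V →₀ ℕ, K.IsFace s.support → coeff s f = 0 := by
  have hI : K.faceIdeal = Ideal.span ((fun s => monomial s (1 : ℝ)) ''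
      {s : V →₀ ℕ | ¬ K.IsFace s.support}) := by
    rw [faceIdeal]; congr 1; ext p; simp [eq_comm]
  rw [hI, mem_ideal_span_monomial_image]
  constructor
  · intro h s hs
    by_contra hc
    obtain ⟨i, hi, hsi⟩ := h s (mem_support_iff.2 hc)
    exact hi (IsFace.subset hs (Finsupp.support_mono hsi))
  · intro h m hm
    exact ⟨m, fun hf => mem_support_iff.1 hm (h m hf), le_rfl⟩

theorem isFace_empty (K : PreAbstractSimplicialComplex V) : K.IsFace ∅ := Or.inl rfl

theorem IsFace.card_le_rank {K : PreAbstractSimplicialComplex V} {F : Finset V} (hF : K.IsFace F) :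
    F.card ≤ K.rank := by
  classical
  exact Finset.le_sup (f := Finset.card) (by simp [hF])

theorem exists_isFace_card_eq_rank (K : PreAbstractSimplicialComplex V) :
    ∃ F, K.IsFace F ∧ F.card = K.rank := by
  classical
  obtain ⟨F, hF, h⟩ := Finset.exists_mem_eq_sup (Finset.univ.filter fun F : Finset V => K.IsFace F)
    ⟨∅, by simp [isFace_empty]⟩ Finset.card
  exact ⟨F, (Finset.mem_filter.1 hF).2, by rw [rank, ← h]⟩

theorem faceIdeal_le_coordIdeal {K : PreAbstractSimplicialComplex V} {F : Finset V}
    (hF : K.IsFace F) : K.faceIdeal ≤ coordIdeal F := by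
  intro f hf
  rw [mem_coordIdeal_iff]
  intro s hs
  exact (mem_faceIdeal_iff K).1 hf s (hF.subset hs)

theorem finite_quotient_of_le {I J : Ideal (MvPolynomial V ℝ)} (h : I ≤ J)
    (hI : Module.Finite ℝ (MvPolynomial V ℝ ⧸ I)) : Module.Finite ℝ (MvPolynomial V ℝ ⧸ J) :=
  Module.Finite.of_surjective (Ideal.Quotient.factorₐ ℝ h).toLinearMap
    (Ideal.Quotient.factor_surjective h)

/-- A linear system of parameters restricts to a spanning set of linear forms on each face. -/
theorem sup_vanishing_eq_top {K : PreAbstractSimplicialComplex V} {ι : Type*} {t : ι → V → ℝ}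
    (hfin : Module.Finite ℝ (K.ReducedRing fun a => linForm (t a))) {F : Finset V}
    (hF : K.IsFace F) : Submodule.span ℝ (Set.range t) ⊔ vanishing F = ⊤ := by
  apply eq_top_of_finite_quotient_linIdeal
  refine finite_quotient_of_le ?_ hfin
  rw [linIdeal_sup, linIdeal_span, reductionIdeal, ← Set.range_comp]
  exact sup_le (le_sup_of_le_right (faceIdeal_le_coordIdeal hF)) le_sup_left

/-- Finite dependent choice: the condition on the term `r` may depend on the earlier terms, and `hP`
says that it depends on nothing else. -/
theorem exists_seq_of_forall_exists {α : Type*} [Inhabited α] (P : (r : ℕ) → (ℕ → α) → α → Prop)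
    (hP : ∀ r f g a, (∀ i < r, f i = g i) → P r f a → P r g a) (d : ℕ)
    (h : ∀ r < d, ∀ f, (∀ i < r, P i f (f i)) → ∃ a, P r f a) :
    ∃ f : ℕ → α, ∀ r < d, P r f (f r) := by
  suffices ∀ m ≤ d, ∃ f : ℕ → α, ∀ r < m, P r f (f r) from this d le_rfl
  intro m
  induction m with
  | zero => exact fun _ => ⟨fun _ => default, fun r hr => absurd hr (Nat.not_lt_zero _)⟩
  | succ m ih =>
    intro hm
    obtain ⟨f, hf⟩ := ih (by omega)
    obtain ⟨a, ha⟩ := h m (by omega) f hf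
    refine ⟨Function.update f m a, fun r hr => ?_⟩
    have hag : ∀ i < r, f i = Function.update f m a i := fun i hi => by
      rw [Function.update_of_ne (by omega)]
    rcases Nat.lt_succ_iff_lt_or_eq.1 hr with h1 | rfl
    · rw [Function.update_of_ne (by omega)]
      exact hP _ _ _ _ hag (hf r h1)
    · rw [Function.update_self]
      exact hP _ _ _ _ hag ha

/-- Generic combinations of a linear system of parameters: the first `r + 1` of them are
independent on each face with more than `r` elements. -/
theorem exists_generic_parameters {K : PreAbstractSimplicialComplex V} {t : Fin K.rank → V → ℝ}
    (hfin : Module.Finite ℝ (K.ReducedRing fun a => linForm (t a))) :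
    ∃ θ : ℕ → V → ℝ, Submodule.span ℝ (θ '' Set.Iio K.rank) = Submodule.span ℝ (Set.range t) ∧
      ∀ r, ∀ F, K.IsFace F → r < F.card →
        θ r ∉ Submodule.span ℝ (θ '' Set.Iio r) ⊔ vanishing F := by
  classical
  set T := Submodule.span ℝ (Set.range t) with hT
  have hrank : ∀ (θ : ℕ → V → ℝ) (r : ℕ), Module.finrank ℝ (Submodule.span ℝ (θ '' Set.Iio r)) ≤ r := by
    intro θ r
    have := finrank_span_finset_le_card (R := ℝ) ((Finset.range r).image θ)
    rw [Finset.coe_image, Finset.coe_range] at this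
    exact this.trans (Finset.card_image_le.trans (by simp))
  obtain ⟨θ, hθ⟩ := exists_seq_of_forall_exists
    (fun r (f : ℕ → V → ℝ) a => a ∈ T ∧ ∀ F, K.IsFace F → r < F.card →
      a ∉ Submodule.span ℝ (f '' Set.Iio r) ⊔ vanishing F)
    (fun r f g a hfg hP => by
      have : f '' Set.Iio r = g '' Set.Iio r := Set.image_congr fun i hi => hfg i hi
      rwa [← this]) K.rank (by
      intro r hr f hf
      -- The new vector must avoid one subspace of `T` per face with more than `r` elements. Over
      -- the infinite field `ℝ` this is possible as soon as each of these subspaces is proper.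
      let s : Finset (Submodule ℝ T) :=
        ((Finset.univ : Finset (Finset V)).filter fun F => K.IsFace F ∧ r < F.card).image
          fun F => (Submodule.span ℝ (f '' Set.Iio r) ⊔ vanishing F).comap T.subtype
      have hs : ⊤ ∉ (s : Set (Submodule ℝ T)) := by
        intro hmem
        simp only [s, Finset.coe_image, Set.mem_image, Finset.mem_coe, Finset.mem_filter,
          Finset.mem_univ, true_and] at hmem
        obtain ⟨F, ⟨hF, hrF⟩, htop⟩ := hmem
        rw [Submodule.comap_subtype_eq_top] at htop
        have h1 := sup_vanishing_eq_top hfin hF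
        have h2 : Submodule.span ℝ (f '' Set.Iio r) ⊔ vanishing F = ⊤ := by
          rw [eq_top_iff, ← h1]
          exact sup_le htop le_sup_right
        -- The sum has dimension at most `r + (|V| - |F|)`, which is less than `|V|`.
        have h3 := Submodule.finrank_add_le_finrank_add_finrank
          (Submodule.span ℝ (f '' Set.Iio r)) (vanishing F)
        rw [h2, finrank_top, Module.finrank_fintype_fun_eq_card] at h3
        have h4 := finrank_vanishing F
        have h5 := hrank f r
        omega
      have := Subspace.biUnion_ne_univ_of_top_notMem hs
      rw [Set.ne_univ_iff_exists_notMem] at this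
      obtain ⟨a, ha⟩ := this
      refine ⟨a, a.2, fun F hF hrF hmem => ha ?_⟩
      refine Set.mem_biUnion (x := (Submodule.span ℝ (f '' Set.Iio r) ⊔ vanishing F).comap T.subtype)
        ?_ hmem
      exact Finset.mem_coe.2 (Finset.mem_image.2 ⟨F, by simp [hF, hrF], rfl⟩))
  refine ⟨θ, ?_, fun r F hF hr => (hθ r (hr.trans_le hF.card_le_rank)).2 F hF hr⟩
  have hle : Submodule.span ℝ (θ '' Set.Iio K.rank) ≤ T := by
    refine Submodule.span_le.2 ?_
    rintro _ ⟨i, hi, rfl⟩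
    exact (hθ i hi).1
  refine Submodule.eq_of_le_of_finrank_le hle ?_
  have h1 : Module.finrank ℝ T ≤ K.rank := (finrank_range_le_card t).trans (by simp)
  refine h1.trans ?_
  -- A face of maximal size forces each new `θ m` out of the span of its predecessors, so the spans
  -- grow to dimension `K.rank`, the most that `T` can have.
  obtain ⟨F, hF, hFc⟩ := exists_isFace_card_eq_rank K
  have : ∀ m ≤ K.rank, m ≤ Module.finrank ℝ (Submodule.span ℝ (θ '' Set.Iio m)) := by
    intro m
    induction m with
    | zero => simp
    | succ m ih =>
      intro hm
      refine Nat.succ_le_of_lt ((ih (by omega)).trans_lt ?_)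
      refine Submodule.finrank_lt_finrank_of_lt (lt_of_le_of_ne
        (Submodule.span_mono (Set.image_mono (Set.Iio_subset_Iio (by omega)))) fun heq => ?_)
      refine (hθ m (by omega)).2 F hF (by omega) (Submodule.mem_sup_left ?_)
      rw [heq]
      exact Submodule.subset_span ⟨m, by simp, rfl⟩
  exact this _ le_rfl

end LinearForms

/-! ### Relative homology via links, and the fundamental cycle of a homology sphere -/

section Boundary

variable {V : Type*} [Fintype V] [LinearOrder V] {k : Type*} [CommRing k]

theorem boundaryMap_apply (c : Finset V → k) (F : Finset V) :
    boundaryMap k c F =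
      ∑ v, if v ∈ F then 0 else (-1 : k) ^ (F.filter (· < v)).card * c (insert v F) := by
  have h1 : boundaryMap k c F = ∑ G, ∑ v, if v ∈ G ∧ G.erase v = F then
      (-1 : k) ^ (G.filter (· < v)).card * c G else 0 := by
    rw [boundaryMap, Fintype.linearCombination_apply, Finset.sum_apply]
    refine Finset.sum_congr rfl fun G _ => ?_
    rw [Pi.smul_apply, Finset.sum_apply, smul_eq_mul, Finset.mul_sum, ← Finset.sum_filter_add_sum_filter_not Finset.univ (· ∈ G)]
    rw [Finset.sum_eq_zero (s := Finset.univ.filter fun v => ¬ v ∈ G)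
      (fun v hv => if_neg fun h => (Finset.mem_filter.1 hv).2 h.1), add_zero, Finset.filter_mem_eq_inter,
      Finset.univ_inter]
    refine Finset.sum_congr rfl fun v hv => ?_
    simp only [hv, true_and, Pi.single_apply, eq_comm (a := F)]
    split_ifs <;> ring
  rw [h1, Finset.sum_comm]
  refine Finset.sum_congr rfl fun v _ => ?_
  by_cases hv : v ∈ F
  · rw [if_pos hv]
    refine Finset.sum_eq_zero fun G _ => if_neg ?_
    rintro ⟨-, rfl⟩
    exact Finset.notMem_erase _ _ hv
  · rw [if_neg hv, Finset.sum_eq_single (insert v F)]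
    · rw [if_pos ⟨Finset.mem_insert_self _ _, Finset.erase_insert hv⟩, Finset.filter_insert,
        if_neg (lt_irrefl v)]
    · intro G _ hG
      refine if_neg ?_
      rintro ⟨h, rfl⟩
      exact hG (Finset.insert_erase h).symm
    · simp

/-- The double boundary is a sum over ordered pairs of vertices whose terms change sign when the
pair is swapped. The sum thus equals its own negative, and `2` can be cancelled. -/
theorem boundaryMap_boundaryMap [NoZeroDivisors k] [CharZero k] (c : Finset V → k) :
    boundaryMap k (boundaryMap k c) = 0 := by
  funext F
  let g : V → V → k := fun v w => if v ∈ F ∨ w ∈ F ∨ v = w then 0 else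
    (-1 : k) ^ (F.filter (· < v)).card * ((-1 : k) ^ ((insert v F).filter (· < w)).card *
      c (insert w (insert v F)))
  have h1 : boundaryMap k (boundaryMap k c) F = ∑ v, ∑ w, g v w := by
    rw [boundaryMap_apply]
    refine Finset.sum_congr rfl fun v _ => ?_
    by_cases hv : v ∈ F
    · simp [hv, g]
    · rw [if_neg hv, boundaryMap_apply, Finset.mul_sum]
      refine Finset.sum_congr rfl fun w _ => ?_
      simp only [g, hv, false_or, Finset.mem_insert]
      by_cases hw : w ∈ F
      · simp [hw]
      · by_cases hvw : v = w
        · simp [hvw]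
        · simp [hw, hvw, Ne.symm hvw]
  have h2 : ∀ v w, g v w = - g w v := by
    intro v w
    simp only [g]
    by_cases hv : v ∈ F
    · simp [hv]
    by_cases hw : w ∈ F
    · simp [hw]
    by_cases hvw : v = w
    · simp [hvw]
    have hins : ∀ a b : V, a ∉ F → (-1 : k) ^ ((insert a F).filter (· < b)).card =
        (if a < b then -1 else 1) * (-1 : k) ^ (F.filter (· < b)).card := by
      intro a b ha
      rw [Finset.filter_insert]
      split_ifs with h
      · rw [Finset.card_insert_of_notMem (by simp [ha]), pow_succ]; ring
      · rw [one_mul]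
    simp only [hv, hw, hvw, Ne.symm hvw, or_self, if_false]
    rw [hins v w hv, hins w v hw, Finset.insert_comm w v F]
    rcases lt_or_gt_of_ne hvw with h | h
    · rw [if_pos h, if_neg h.not_gt]; ring
    · rw [if_pos h, if_neg h.not_gt]; ring
  have h3 : ∑ v, ∑ w, g v w = - ∑ v, ∑ w, g v w := by
    conv_lhs => rw [Finset.sum_comm]
    rw [← Finset.sum_neg_distrib]
    refine Finset.sum_congr rfl fun w _ => ?_
    rw [← Finset.sum_neg_distrib]
    exact Finset.sum_congr rfl fun v _ => h2 _ _
  rw [h1, Pi.zero_apply]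
  have h4 : (2 : k) * ∑ v, ∑ w, g v w = 0 := by linear_combination h3
  exact (mul_eq_zero.1 h4).resolve_left two_ne_zero

theorem mem_chains_iff {K : PreAbstractSimplicialComplex V} {p : ℕ} {c : Finset V → k} :
    c ∈ chains k K p ↔ ∀ F, c F ≠ 0 → K.IsFace F ∧ F.card = p := by
  constructor
  · intro h
    refine Submodule.span_induction (p := fun c _ => ∀ F, c F ≠ 0 → K.IsFace F ∧ F.card = p)
      ?_ ?_ ?_ ?_ h
    · rintro _ ⟨G, hG, rfl⟩ F hF
      have : F = G := by
        by_contra hne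
        exact hF (by simp [hne])
      exact this ▸ hG
    · simp
    · intro x y _ _ hx hy F hF
      by_cases h0 : x F = 0
      · exact hy F fun h1 => hF (by simp [h0, h1])
      · exact hx F h0
    · intro a x _ hx F hF
      exact hx F fun h0 => hF (by simp [h0])
  · intro h
    rw [pi_eq_sum_univ' c]
    refine Submodule.sum_mem _ fun F _ => ?_
    by_cases hF : c F = 0
    · simp [hF]
    · refine Submodule.smul_mem _ _ (Submodule.subset_span ⟨F, h F hF, ?_⟩)
      ext i; simp [Pi.single_apply, eq_comm]

theorem boundaryMap_mem_chains {K : PreAbstractSimplicialComplex V} {p : ℕ} {c : Finset V → k}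
    (hc : c ∈ chains k K (p + 1)) : boundaryMap k c ∈ chains k K p := by
  rw [mem_chains_iff] at hc ⊢
  intro F hF
  rw [boundaryMap_apply] at hF
  obtain ⟨v, -, hv⟩ := Finset.exists_ne_zero_of_sum_ne_zero hF
  have hvF : v ∉ F := fun h => hv (if_pos h)
  rw [if_neg hvF] at hv
  obtain ⟨h1, h2⟩ := hc _ (right_ne_zero_of_mul hv)
  rw [Finset.card_insert_of_notMem hvF] at h2
  exact ⟨h1.subset (Finset.subset_insert _ _), by omega⟩

theorem boundaries_le_cycles [NoZeroDivisors k] [CharZero k] (K : PreAbstractSimplicialComplex V)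
    (p : ℕ) : boundaries k K p ≤ cycles k K p := by
  rintro _ ⟨c, hc, rfl⟩
  exact ⟨boundaryMap_mem_chains hc, boundaryMap_boundaryMap c⟩

theorem exists_boundary_of_subsingleton {K : PreAbstractSimplicialComplex V} {p : ℕ}
    (h : Subsingleton (ReducedHomology k K p)) {c : Finset V → k} (hc : c ∈ cycles k K p) :
    ∃ b ∈ chains k K (p + 1), boundaryMap k b = c := by
  have h1 := Submodule.Quotient.subsingleton_iff.1 h
  have h2 : (⟨c, hc⟩ : cycles k K p) ∈ (boundaries k K p).submoduleOf (cycles k K p) :=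
    h1 ▸ Submodule.mem_top
  exact h2

theorem boundaries_rank (K : PreAbstractSimplicialComplex V) : boundaries k K K.rank = ⊥ := by
  have : chains k K (K.rank + 1) = ⊥ := by
    rw [eq_bot_iff]
    intro c hc
    rw [mem_chains_iff] at hc
    rw [Submodule.mem_bot]
    funext F
    by_contra hF
    obtain ⟨h1, h2⟩ := hc F hF
    have := h1.card_le_rank
    omega
  rw [boundaries, this, Submodule.map_bot]

/-- In top degree there are no boundaries, so the cycles are the homology. -/
theorem finrank_cycles_rank {K : PreAbstractSimplicialComplex V} (h : K.HasSphereHomology ℝ) :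
    Module.finrank ℝ (cycles ℝ K K.rank) = 1 := by
  obtain ⟨e⟩ := h.2
  have h1 := e.finrank_eq
  have h2 : (boundaries ℝ K K.rank).submoduleOf (cycles ℝ K K.rank) = ⊥ := by
    rw [boundaries_rank, Submodule.submoduleOf, Submodule.comap_bot, LinearMap.ker_eq_bot]
    exact Subtype.val_injective
  rw [← ((Submodule.quotEquivOfEqBot _ h2).finrank_eq), h1, Module.finrank_self]

theorem exists_smul_eq_of_mem_cycles_rank {K : PreAbstractSimplicialComplex V}
    (h : K.HasSphereHomology ℝ) {c c' : Finset V → ℝ} (hc : c ∈ cycles ℝ K K.rank)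
    (hc' : c' ∈ cycles ℝ K K.rank) (h0 : c' ≠ 0) : ∃ r : ℝ, c = r • c' := by
  have h1 : (⟨c', hc'⟩ : cycles ℝ K K.rank) ≠ 0 := fun h => h0 (congrArg Subtype.val h)
  obtain ⟨r, hr⟩ := (finrank_eq_one_iff_of_nonzero' _ h1).1 (finrank_cycles_rank h) ⟨c, hc⟩
  exact ⟨r, (congrArg Subtype.val hr).symm⟩

theorem isFace_link_iff {K : PreAbstractSimplicialComplex V} {G L : Finset V} (hG : K.IsFace G) :
    (K.link G).IsFace L ↔ Disjoint L G ∧ K.IsFace (L ∪ G) := by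
  constructor
  · rintro (rfl | ⟨-, h1, h2⟩)
    · simpa using hG
    · exact ⟨h1, Or.inr h2⟩
  · rintro ⟨h1, h2⟩
    rcases Finset.eq_empty_or_nonempty L with h | h
    · exact Or.inl h
    · refine Or.inr ⟨h, h1, h2.resolve_left fun h3 => ?_⟩
      exact h.ne_empty (Finset.union_eq_empty.1 h3).1

theorem rank_link {K : PreAbstractSimplicialComplex V} (hK : K.IsPure) {G : Finset V}
    (hG : K.IsFace G) : (K.link G).rank + G.card = K.rank := by
  apply le_antisymm
  · obtain ⟨L, hL, hLc⟩ := exists_isFace_card_eq_rank (K.link G)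
    rw [isFace_link_iff hG] at hL
    rw [← hLc, ← Finset.card_union_of_disjoint hL.1]
    exact hL.2.card_le_rank
  · obtain ⟨F, hF, hGF, hc⟩ := hK G hG
    have : (K.link G).IsFace (F \ G) := by
      rw [isFace_link_iff hG]
      exact ⟨Finset.sdiff_disjoint, by rwa [Finset.sdiff_union_of_subset hGF]⟩
    have h2 := this.card_le_rank
    rw [Finset.card_sdiff_of_subset hGF] at h2
    omega

/-- The sign relating faces of the link of `G` to faces that contain `G`. -/
def linkSign (G L : Finset V) : ℝ := ∏ v ∈ L, (-1 : ℝ) ^ (G.filter (· < v)).card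

theorem linkSign_mul_self (G L : Finset V) : linkSign G L * linkSign G L = 1 := by
  rw [linkSign, ← Finset.prod_mul_distrib]
  refine Finset.prod_eq_one fun v _ => ?_
  rw [← mul_pow]; simp

/-- The restriction of a chain to the faces containing `G`, as a chain of the link of `G`. -/
def toLink (G : Finset V) (c : Finset V → ℝ) : Finset V → ℝ := fun L =>
  if Disjoint L G then linkSign G L * c (L ∪ G) else 0

/-- A chain of the link of `G`, as a chain on the faces containing `G`. -/
def ofLink (G : Finset V) (c : Finset V → ℝ) : Finset V → ℝ := fun F =>
  if G ⊆ F then linkSign G (F \ G) * c (F \ G) else 0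

theorem toLink_sdiff {G F : Finset V} (h : G ⊆ F) (c : Finset V → ℝ) :
    toLink G c (F \ G) = linkSign G (F \ G) * c F := by
  rw [toLink, if_pos Finset.sdiff_disjoint, Finset.sdiff_union_of_subset h]

theorem toLink_eq_zero_iff {G : Finset V} {c : Finset V → ℝ} :
    toLink G c = 0 ↔ ∀ F, G ⊆ F → c F = 0 := by
  constructor
  · intro h F hF
    have h1 := toLink_sdiff hF c
    rw [h, Pi.zero_apply] at h1
    have h2 := linkSign_mul_self G (F \ G)
    exact (mul_eq_zero.1 h1.symm).resolve_left fun h0 => by simp [h0] at h2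
  · intro h
    funext L
    simp [toLink, h (L ∪ G) Finset.subset_union_right]

theorem toLink_ofLink {G : Finset V} {c : Finset V → ℝ} (hc : ∀ L, c L ≠ 0 → Disjoint L G) :
    toLink G (ofLink G c) = c := by
  funext L
  rw [toLink]
  split_ifs with h
  · rw [ofLink, if_pos Finset.subset_union_right, Finset.union_sdiff_cancel_right h, ← mul_assoc,
      linkSign_mul_self, one_mul]
  · by_contra h0
    exact h (hc L fun h1 => h0 h1.symm)

theorem toLink_sub (G : Finset V) (c c' : Finset V → ℝ) :
    toLink G (c - c') = toLink G c - toLink G c' := by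
  funext L
  simp only [toLink, Pi.sub_apply]
  split_ifs <;> ring

theorem toLink_smul (G : Finset V) (r : ℝ) (c : Finset V → ℝ) :
    toLink G (r • c) = r • toLink G c := by
  funext L
  simp only [toLink, Pi.smul_apply, smul_eq_mul]
  split_ifs <;> ring

/-- The number of elements of `L ∪ G` below `v` splits into a part from `L` and a part from `G`; the
factor that `v` contributes to `linkSign` absorbs the second. Chains modulo faces not containing `G`
thus become chains of the link. -/
theorem boundaryMap_toLink (G : Finset V) (c : Finset V → ℝ) :
    boundaryMap ℝ (toLink G c) = toLink G (boundaryMap ℝ c) := by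
  funext L
  rw [boundaryMap_apply, toLink, boundaryMap_apply]
  by_cases hL : Disjoint L G
  · rw [if_pos hL, Finset.mul_sum]
    refine Finset.sum_congr rfl fun v _ => ?_
    by_cases hvL : v ∈ L
    · simp [hvL]
    by_cases hvG : v ∈ G
    · simp [hvL, hvG, toLink]
    rw [if_neg hvL, if_neg (by simp [hvL, hvG]), toLink,
      if_pos (by rw [Finset.disjoint_insert_left]; exact ⟨hvG, hL⟩), linkSign,
      Finset.prod_insert hvL, ← linkSign, Finset.filter_union, Finset.card_union_of_disjoint
      (Finset.disjoint_filter_filter hL), pow_add, Finset.insert_union]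
    ring
  · rw [if_neg hL]
    refine Finset.sum_eq_zero fun v _ => ?_
    split_ifs
    · rfl
    · rw [toLink, if_neg, mul_zero]
      exact fun h => hL (h.mono_left (Finset.subset_insert _ _))

theorem toLink_mem_chains {K : PreAbstractSimplicialComplex V} {G : Finset V} (hG : K.IsFace G)
    {p : ℕ} {c : Finset V → ℝ} (hc : c ∈ chains ℝ K (p + G.card)) :
    toLink G c ∈ chains ℝ (K.link G) p := by
  rw [mem_chains_iff] at hc ⊢
  intro L hL
  rw [toLink] at hL
  split_ifs at hL with h
  · obtain ⟨h1, h2⟩ := hc _ (right_ne_zero_of_mul hL)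
    rw [Finset.card_union_of_disjoint h] at h2
    exact ⟨(isFace_link_iff hG).2 ⟨h, h1⟩, by omega⟩
  · exact absurd rfl hL

theorem ofLink_mem_chains {K : PreAbstractSimplicialComplex V} {G : Finset V} (hG : K.IsFace G)
    {p : ℕ} {c : Finset V → ℝ} (hc : c ∈ chains ℝ (K.link G) p) :
    ofLink G c ∈ chains ℝ K (p + G.card) := by
  rw [mem_chains_iff] at hc ⊢
  intro F hF
  rw [ofLink] at hF
  split_ifs at hF with h
  · obtain ⟨h1, h2⟩ := hc _ (right_ne_zero_of_mul hF)
    have h3 := ((isFace_link_iff hG).1 h1).2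
    rw [Finset.sdiff_union_of_subset h] at h3
    rw [Finset.card_sdiff_of_subset h] at h2
    have := Finset.card_le_card h
    exact ⟨h3, by omega⟩
  · exact absurd rfl hF

theorem disjoint_of_mem_chains_link {K : PreAbstractSimplicialComplex V} {G : Finset V}
    (hG : K.IsFace G) {p : ℕ} {c : Finset V → ℝ} (hc : c ∈ chains ℝ (K.link G) p) (L : Finset V)
    (hL : c L ≠ 0) : Disjoint L G :=
  ((isFace_link_iff hG).1 (mem_chains_iff.1 hc L hL).1).1

/-- A cycle relative to the faces not containing `G` is a cycle of the link of `G`, shifted by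
`G.card`, and below the top degree the link has no homology. If `G` has more than `i` elements there
is nothing to bound. -/
theorem IsGorensteinStar.exists_relative_boundary {K : PreAbstractSimplicialComplex V}
    (hK : K.IsGorensteinStar ℝ) {G : Finset V} (hG : K.IsFace G) {i : ℕ} (hi : i < K.rank)
    {c : Finset V → ℝ} (hc : c ∈ chains ℝ K i) (hb : ∀ F, G ⊆ F → boundaryMap ℝ c F = 0) :
    ∃ b ∈ chains ℝ K (i + 1), ∀ F, G ⊆ F → c F = boundaryMap ℝ b F := by
  by_cases hGi : G.card ≤ i
  · obtain ⟨p, rfl⟩ := Nat.exists_eq_add_of_le' hGi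
    have hr := rank_link hK.1 hG
    have h1 : toLink G c ∈ cycles ℝ (K.link G) p :=
      ⟨toLink_mem_chains hG hc, by
        rw [SetLike.mem_coe, LinearMap.mem_ker, boundaryMap_toLink, toLink_eq_zero_iff]; exact hb⟩
    obtain ⟨b, hb, hbc⟩ := exists_boundary_of_subsingleton
      ((hK.2 G hG).1 p (by omega)) h1
    refine ⟨ofLink G b, ?_, fun F hF => ?_⟩
    · have := ofLink_mem_chains hG hb
      rwa [Nat.add_right_comm] at this
    · have h2 : toLink G (c - boundaryMap ℝ (ofLink G b)) = 0 := by
        rw [toLink_sub, ← boundaryMap_toLink, toLink_ofLink (disjoint_of_mem_chains_link hG hb), hbc,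
          sub_self]
      exact sub_eq_zero.1 (toLink_eq_zero_iff.1 h2 F hF)
  · refine ⟨0, Submodule.zero_mem _, fun F hF => ?_⟩
    rw [map_zero, Pi.zero_apply]
    by_contra h0
    have := (mem_chains_iff.1 hc F h0).2
    have := Finset.card_le_card hF
    omega

/-- In top degree the link of `G` has a one-dimensional space of cycles, so two relative cycles are
proportional. -/
theorem IsGorensteinStar.exists_relative_smul_eq {K : PreAbstractSimplicialComplex V}
    (hK : K.IsGorensteinStar ℝ) {G : Finset V} (hG : K.IsFace G)
    {c c' : Finset V → ℝ} (hc : c ∈ chains ℝ K K.rank)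
    (hb : ∀ F, G ⊆ F → boundaryMap ℝ c F = 0) (hc' : c' ∈ chains ℝ K K.rank)
    (hb' : ∀ F, G ⊆ F → boundaryMap ℝ c' F = 0) (h0 : ∃ F, G ⊆ F ∧ c' F ≠ 0) :
    ∃ r : ℝ, ∀ F, G ⊆ F → c F = r * c' F := by
  have hr := rank_link hK.1 hG
  have key : ∀ x : Finset V → ℝ, x ∈ chains ℝ K K.rank → (∀ F, G ⊆ F → boundaryMap ℝ x F = 0) →
      toLink G x ∈ cycles ℝ (K.link G) (K.link G).rank := by
    intro x hx hbx
    refine ⟨toLink_mem_chains hG (by rwa [hr]), ?_⟩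
    rw [SetLike.mem_coe, LinearMap.mem_ker, boundaryMap_toLink, toLink_eq_zero_iff]
    exact hbx
  obtain ⟨r, hr⟩ := exists_smul_eq_of_mem_cycles_rank (hK.2 G hG) (key c hc hb) (key c' hc' hb')
    (fun h => by
      obtain ⟨F, hF, hF0⟩ := h0
      exact hF0 (toLink_eq_zero_iff.1 h F hF))
  refine ⟨r, fun F hF => ?_⟩
  have h2 : toLink G (c - r • c') = 0 := by rw [toLink_sub, toLink_smul, hr, sub_self]
  exact sub_eq_zero.1 (toLink_eq_zero_iff.1 h2 F hF)

theorem boundaryMap_single (F : Finset V) (a : k) : boundaryMap k (Pi.single F a) =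
    a • ∑ v ∈ F, Pi.single (F.erase v) ((-1 : k) ^ (F.filter (· < v)).card) := by
  rw [boundaryMap, Fintype.linearCombination_apply_single]

/-- A set of vertices of a link that is closed under adjacency contains all or none of them. -/
theorem mem_of_adjacency_closed {K : PreAbstractSimplicialComplex V}
    (h : Subsingleton (ReducedHomology ℝ K 1)) {U : Set V}
    (hU : ∀ a b, a ∈ U → K.IsFace {a, b} → b ∈ U) {u w : V} (hu : u ∈ U) (hu' : K.IsFace {u})
    (hw : K.IsFace {w}) : w ∈ U := by
  classical
  have hc : (Pi.single {u} 1 - Pi.single {w} 1 : Finset V → ℝ) ∈ cycles ℝ K 1 := by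
    refine ⟨Submodule.sub_mem _ (Submodule.subset_span ⟨_, ⟨hu', by simp⟩, rfl⟩)
      (Submodule.subset_span ⟨_, ⟨hw, by simp⟩, rfl⟩), ?_⟩
    rw [SetLike.mem_coe, LinearMap.mem_ker, map_sub, boundaryMap_single, boundaryMap_single]
    simp [Finset.filter_singleton]
  obtain ⟨b, hb, hbc⟩ := exists_boundary_of_subsingleton h hc
  -- `φ` adds the coefficients of the vertices in `U`. An edge has both ends in `U` or neither, so
  -- `φ` kills boundaries; on `[u] - [w]` it would be `1` if `w ∉ U`.
  let φ : (Finset V → ℝ) →ₗ[ℝ] ℝ :=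
    ∑ v : V, (if v ∈ U then (1 : ℝ) else 0) • LinearMap.proj ({v} : Finset V)
  have hφ : ∀ v, φ (Pi.single {v} 1) = if v ∈ U then (1 : ℝ) else 0 := by
    intro v
    simp only [φ, LinearMap.sum_apply, LinearMap.smul_apply, LinearMap.proj_apply,
      Pi.single_apply, Finset.singleton_inj, smul_eq_mul, mul_ite, mul_one, mul_zero]
    simp
  have hφb : φ (boundaryMap ℝ b) = 0 := by
    have : chains ℝ K 2 ≤ LinearMap.ker (φ ∘ₗ boundaryMap ℝ) := by
      refine Submodule.span_le.2 ?_
      rintro _ ⟨F, ⟨hF, hF2⟩, rfl⟩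
      obtain ⟨x, y, hxy, rfl⟩ := Finset.card_eq_two.1 hF2
      have hiff : x ∈ U ↔ y ∈ U :=
        ⟨fun hx => hU x y hx hF, fun hy => hU y x hy (by rwa [Finset.pair_comm])⟩
      have e1 : ({x, y} : Finset V).erase x = {y} := by
        ext z; simp only [Finset.mem_erase, Finset.mem_insert, Finset.mem_singleton]; grind
      have e2 : ({x, y} : Finset V).erase y = {x} := by
        ext z; simp only [Finset.mem_erase, Finset.mem_insert, Finset.mem_singleton]; grind
      have hs : ∀ (z : V) (r : ℝ), φ (Pi.single {z} r) = r * if z ∈ U then (1 : ℝ) else 0 := by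
        intro z r
        rw [← hφ, ← smul_eq_mul, ← map_smul, ← Pi.single_smul, smul_eq_mul, mul_one]
      simp only [SetLike.mem_coe, LinearMap.mem_ker, LinearMap.comp_apply, boundaryMap_single,
        one_smul]
      rw [Finset.sum_pair hxy, e1, e2, map_add, hs, hs, Finset.filter_insert, Finset.filter_insert,
        Finset.filter_singleton, Finset.filter_singleton]
      rcases lt_or_gt_of_ne hxy with h | h
      · by_cases hy : y ∈ U <;> simp [h, h.not_gt, hiff, hy]
      · by_cases hy : y ∈ U <;> simp [h, h.not_gt, hiff, hy]
    exact this hb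
  rw [hbc, map_sub, hφ, hφ, if_pos hu] at hφb
  by_contra hwU
  rw [if_neg hwU] at hφb
  norm_num at hφb

/-- A relative top cycle vanishes on all facets containing `G`, or on none of them. -/
theorem IsGorensteinStar.relative_cycle_eq_zero {K : PreAbstractSimplicialComplex V}
    (hK : K.IsGorensteinStar ℝ) {c : Finset V → ℝ} (hc : c ∈ chains ℝ K K.rank) :
    ∀ (e : ℕ) (G : Finset V), K.IsFace G → G.card + e = K.rank →
      (∀ F, G ⊆ F → boundaryMap ℝ c F = 0) → ∀ F₀, K.IsFace F₀ → F₀.card = K.rank → G ⊆ F₀ →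
      c F₀ = 0 → ∀ F, G ⊆ F → c F = 0 := by
  intro e
  induction e with
  | zero =>
    intro G _ hGc _ F₀ _ hF₀c hGF₀ h0 F hF
    by_contra hcF
    have h1 := Finset.eq_of_subset_of_card_le hGF₀ (by omega)
    have h2 := Finset.eq_of_subset_of_card_le hF (by rw [(mem_chains_iff.1 hc F hcF).2]; omega)
    exact hcF (by rw [← h2, h1, h0])
  | succ e ih =>
    intro G hG hGc hb F₀ hF₀ hF₀c hGF₀ h0 F hF
    by_contra hcF
    obtain ⟨hFf, hFc⟩ := mem_chains_iff.1 hc F hcF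
    -- In codimension one, any two facets over `G` carry a relative cycle `x` that is nonzero on
    -- exactly these two. Uniqueness up to scalar makes `x` a multiple of `c`, which is impossible
    -- since `c F₀ = 0`. In higher codimension the link of `G` is connected, and vanishing spreads
    -- from vertex to vertex.
    rcases Nat.eq_zero_or_pos e with rfl | he
    · obtain ⟨v₀, hv₀, rfl⟩ : ∃ v, v ∉ G ∧ insert v G = F₀ :=
        Finset.exists_eq_insert_iff.2 ⟨hGF₀, by omega⟩
      obtain ⟨v, hv, rfl⟩ : ∃ v, v ∉ G ∧ insert v G = F :=
        Finset.exists_eq_insert_iff.2 ⟨hF, by omega⟩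
      have hne : insert v G ≠ insert v₀ G := fun h => hcF (h ▸ h0)
      let s : V → ℝ := fun v => (-1) ^ (G.filter (· < v)).card
      have hss : ∀ v, s v * s v = 1 := fun v => by simp only [s]; rw [← mul_pow]; simp
      have hvv : v ≠ v₀ := fun h => hne (by rw [h])
      -- The coefficients are the incidence signs of the two facets with `G`, so the two
      -- contributions to the boundary at `G` are `1` and `-1`.
      let x : Finset V → ℝ := Pi.single (insert v₀ G) (s v₀) - Pi.single (insert v G) (s v)
      have hx0 : x (insert v₀ G) = s v₀ := by simp [x, hne.symm]
      have hxc : x ∈ chains ℝ K K.rank := by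
        rw [mem_chains_iff]
        intro F' hF'
        by_cases h1 : F' = insert v₀ G
        · exact h1 ▸ ⟨hF₀, hF₀c⟩
        · by_cases h2 : F' = insert v G
          · exact h2 ▸ ⟨hFf, hFc⟩
          · exact absurd (by simp [x, h1, h2]) hF'
      have hxb : ∀ F', G ⊆ F' → boundaryMap ℝ x F' = 0 := by
        intro F' hGF'
        by_contra hne0
        have h1 : boundaryMap ℝ x ∈ chains ℝ K G.card := boundaryMap_mem_chains (by
          rwa [hGc])
        have h2 := (mem_chains_iff.1 h1 F' hne0).2
        have h3 := Finset.eq_of_subset_of_card_le hGF' (by omega)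
        subst h3
        apply hne0
        have hinj : ∀ a b, a ∉ G → (insert a G = insert b G ↔ a = b) := by
          intro a b ha
          refine ⟨fun h => ?_, fun h => by rw [h]⟩
          have : a ∈ insert b G := h ▸ Finset.mem_insert_self _ _
          exact (Finset.mem_insert.1 this).resolve_right ha
        have h4 : ∀ w, (if w ∈ G then 0 else (-1 : ℝ) ^ (G.filter (· < w)).card * x (insert w G)) =
            (if w = v₀ then 1 else 0) - (if w = v then 1 else 0) := by
          intro w
          by_cases hw : w ∈ G
          · rw [if_pos hw, if_neg (fun h : w = v₀ => hv₀ (h ▸ hw)),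
              if_neg (fun h : w = v => hv (h ▸ hw)), sub_zero]
          · rw [if_neg hw]
            simp only [x, Pi.sub_apply, Pi.single_apply, hinj w _ hw]
            by_cases hw₀ : w = v₀
            · subst hw₀
              simp only [if_true, hvv.symm, if_false, sub_zero]
              exact hss w
            · by_cases h2 : w = v
              · subst h2
                rw [if_neg hw₀, if_neg hw₀, if_pos rfl, if_pos rfl, zero_sub, zero_sub, mul_neg]
                exact congrArg Neg.neg (hss w)
              · simp [hw₀, h2]
        rw [boundaryMap_apply, Finset.sum_congr rfl fun w _ => h4 w]
        simp
      obtain ⟨r, hr⟩ := hK.exists_relative_smul_eq hG hxc hxb hc hb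
        ⟨_, Finset.subset_insert v G, hcF⟩
      have h1 := hr _ (Finset.subset_insert v₀ G)
      rw [h0, mul_zero, hx0] at h1
      have h2 := hss v₀
      rw [h1, mul_zero] at h2
      exact zero_ne_one h2
    · have hrl := rank_link hK.1 hG
      have hsub : Subsingleton (ReducedHomology ℝ (K.link G) 1) :=
        (hK.2 G hG).1 1 (by omega)
      -- `U` is closed under adjacency in the link: by purity an edge `{a, b}` lies in a facet over
      -- `G`, `c` vanishes there because `a ∈ U`, and the induction hypothesis for `insert b G`
      -- spreads this to all facets over it.
      let U : Set V := {u | u ∉ G ∧ ∀ F', insert u G ⊆ F' → c F' = 0}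
      have step : ∀ a, a ∉ G → ∀ F', K.IsFace F' → F'.card = K.rank → insert a G ⊆ F' →
          c F' = 0 → a ∈ U := by
        intro a ha F' hF' hF'c haF' hcF'
        refine ⟨ha, ih (insert a G) (hF'.subset haF') ?_ ?_ F' hF' hF'c haF' hcF'⟩
        · rw [Finset.card_insert_of_notMem ha]; omega
        · exact fun F'' h => hb F'' ((Finset.subset_insert _ _).trans h)
      have hU : ∀ a b, a ∈ U → (K.link G).IsFace {a, b} → b ∈ U := by
        intro a b ha hab
        rw [isFace_link_iff hG] at hab
        obtain ⟨F', hF', hsub', hF'c⟩ := hK.1 _ hab.2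
        have hbG : b ∉ G := Finset.disjoint_left.1 hab.1 (by simp)
        refine step b hbG F' hF' hF'c ((Finset.insert_subset_iff.2
          ⟨by simp, Finset.subset_union_right⟩).trans hsub') (ha.2 F' ?_)
        exact (Finset.insert_subset_iff.2 ⟨by simp, Finset.subset_union_right⟩).trans hsub'
      have hface : ∀ F', K.IsFace F' → F'.card = K.rank → G ⊆ F' →
          ∃ a, a ∉ G ∧ insert a G ⊆ F' ∧ (K.link G).IsFace {a} := by
        intro F' hF' hF'c hGF'
        obtain ⟨a, haF', haG⟩ := Finset.exists_mem_notMem_of_card_lt_card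
          (show G.card < F'.card by omega)
        have h1 : insert a G ⊆ F' := Finset.insert_subset haF' hGF'
        refine ⟨a, haG, h1, (isFace_link_iff hG).2 ⟨by simpa using haG, ?_⟩⟩
        exact hF'.subset (by simpa using h1)
      obtain ⟨a, haG, haF₀, ha⟩ := hface F₀ hF₀ hF₀c hGF₀
      obtain ⟨b, hbG, hbF, hb'⟩ := hface F hFf hFc hF
      have haU : a ∈ U := step a haG F₀ hF₀ hF₀c haF₀ h0
      have hbU : b ∈ U := mem_of_adjacency_closed hsub hU haU ha hb'
      exact hcF (hbU.2 F hbF)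

/-- The fundamental cycle of a homology sphere is supported on every facet. -/
theorem IsGorensteinStar.exists_fundamental_cycle {K : PreAbstractSimplicialComplex V}
    (hK : K.IsGorensteinStar ℝ) : ∃ μ ∈ chains ℝ K K.rank, boundaryMap ℝ μ = 0 ∧
      ∀ F, K.IsFace F → F.card = K.rank → μ F ≠ 0 := by
  -- The link of the empty face has the same faces as `K`, so its top cycles are those of `K`.
  have hr := rank_link hK.1 (isFace_empty K)
  rw [Finset.card_empty, add_zero] at hr
  have h1 := finrank_cycles_rank (hK.2 ∅ (isFace_empty K))
  have : Nontrivial (cycles ℝ (K.link ∅) (K.link ∅).rank) :=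
    Module.nontrivial_of_finrank_pos (R := ℝ) (by omega)
  obtain ⟨⟨μ, hμ, hμb⟩, hne⟩ := exists_ne (0 : cycles ℝ (K.link ∅) (K.link ∅).rank)
  have hμc : μ ∈ chains ℝ K K.rank := by
    rw [mem_chains_iff]
    intro F hF
    have := mem_chains_iff.1 hμ F hF
    rw [isFace_link_iff (isFace_empty K), hr, Finset.union_empty] at this
    exact ⟨this.1.2, this.2⟩
  refine ⟨μ, hμc, hμb, fun F hF hFc h0 => hne ?_⟩
  have := hK.relative_cycle_eq_zero hμc K.rank ∅ (isFace_empty K) (by simp)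
    (fun F' _ => by rw [LinearMap.mem_ker.1 hμb]; rfl) F hF hFc (Finset.empty_subset _) h0
  ext F'
  exact this F' (Finset.empty_subset _)

end Boundary

/-! ### Passage of weak regularity to kernels -/

section RegularSequences

variable {A M : Type*} [CommRing A] [AddCommGroup M] [Module A M]

/-- `x` lies in `(θ 0, …, θ (r - 1)) P + N`. -/
def IsCombination (N P : Submodule A M) (θ : ℕ → A) (r : ℕ) (x : M) : Prop :=
  ∃ c : ℕ → M, (∀ a, c a ∈ P) ∧ x - ∑ a ∈ Finset.range r, θ a • c a ∈ N

/-- The first `m` elements of `θ` form a weakly regular sequence on `P` modulo `N`. -/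
def IsRegularModulo (N P : Submodule A M) (θ : ℕ → A) (m : ℕ) : Prop :=
  ∀ r < m, ∀ x ∈ P, IsCombination N P θ r (θ r • x) → IsCombination N P θ r x

theorem IsCombination.mono {N P P' : Submodule A M} {θ : ℕ → A} {r : ℕ} {x : M}
    (h : IsCombination N P θ r x) (hP : P ≤ P') : IsCombination N P' θ r x := by
  obtain ⟨c, hc, hx⟩ := h
  exact ⟨c, fun a => hP (hc a), hx⟩

/-- For an exact sequence `0 → Z → P → Z' → 0` modulo `N` with `θ` regular on `Z'`, this says `Z ∩
(θ) P = (θ) Z`. If `x = ∑ θ a • c a` is killed by `f`, regularity on `Z'` puts `f (c r)` in the span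
of the earlier `θ a`. Lifting the coefficients corrects `c r` to an element `y` of `Z`, and the
correction is absorbed by the other `c a`. -/
theorem isCombination_of_map {N P Z' : Submodule A M} {f : M →ₗ[A] M} (hN : ∀ x ∈ N, f x ∈ N)
    (hf : ∀ x ∈ P, f x ∈ Z') (hsurj : ∀ z ∈ Z', ∃ b ∈ P, z - f b ∈ N) {θ : ℕ → A} {m : ℕ}
    (hZ' : IsRegularModulo N Z' θ m) : ∀ r ≤ m, ∀ x ∈ P, f x ∈ N → IsCombination N P θ r x →
      IsCombination N (P ⊓ N.comap f) θ r x := by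
  intro r
  induction r with
  | zero =>
    rintro - x - - ⟨c, -, hx⟩
    exact ⟨fun _ => 0, fun _ => zero_mem _, by simpa using hx⟩
  | succ r ih =>
    rintro hr x hxP hfx ⟨c, hc, hx⟩
    rw [Finset.sum_range_succ] at hx
    have h1 : IsCombination N Z' θ r (θ r • f (c r)) := by
      refine ⟨fun a => - f (c a), fun a => neg_mem (hf _ (hc a)), ?_⟩
      have h2 := sub_mem hfx (hN _ hx)
      have h3 : f x - f (x - (∑ a ∈ Finset.range r, θ a • c a + θ r • c r)) =
          θ r • f (c r) - ∑ a ∈ Finset.range r, θ a • -f (c a) := by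
        simp only [map_sub, map_add, map_sum, map_smul, smul_neg, Finset.sum_neg_distrib]
        abel
      rwa [h3] at h2
    obtain ⟨z, hz, hzx⟩ := hZ' r (by omega) _ (hf _ (hc r)) h1
    choose b hb hzb using fun a => hsurj (z a) (hz a)
    let y := c r - ∑ a ∈ Finset.range r, θ a • b a
    have hyP : y ∈ P :=
      sub_mem (hc r) (Submodule.sum_mem _ fun a _ => Submodule.smul_mem _ _ (hb a))
    have hfy : f y ∈ N := by
      have h2 : f y = (f (c r) - ∑ a ∈ Finset.range r, θ a • z a) +
          ∑ a ∈ Finset.range r, θ a • (z a - f (b a)) := by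
        simp only [y, map_sub, map_sum, map_smul, smul_sub, Finset.sum_sub_distrib]
        abel
      rw [h2]
      exact add_mem hzx (Submodule.sum_mem _ fun a _ => Submodule.smul_mem _ _ (hzb a))
    obtain ⟨c', hc', hx'⟩ := ih (by omega) (x - θ r • y)
      (sub_mem hxP (Submodule.smul_mem _ _ hyP))
      (by rw [map_sub, map_smul]; exact sub_mem hfx (Submodule.smul_mem _ _ hfy))
      ⟨fun a => c a + θ r • b a, fun a => add_mem (hc a) (Submodule.smul_mem _ _ (hb a)), by
        have h2 : x - θ r • y - ∑ a ∈ Finset.range r, θ a • (c a + θ r • b a) =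
            x - (∑ a ∈ Finset.range r, θ a • c a + θ r • c r) := by
          simp only [y, smul_add, smul_sub, Finset.sum_add_distrib, Finset.smul_sum,
            smul_comm (θ r)]
          abel
        rw [h2]
        exact hx⟩
    refine ⟨Function.update c' r y, fun a => ?_, ?_⟩
    · by_cases ha : a = r
      · rw [ha, Function.update_self]; exact ⟨hyP, hfy⟩
      · rw [Function.update_of_ne ha]; exact hc' a
    · rw [Finset.sum_range_succ, Function.update_self, Finset.sum_congr rfl fun a ha => by
        rw [Function.update_of_ne (Finset.mem_range.1 ha).ne]]
      rw [add_comm, ← sub_sub]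
      exact hx'

/-- The depth lemma: the kernel of a surjection can gain one regular element over the image. In the
condition for index `r < m + 1`, `Z'` is only asked to be regular for the indices below `r`. -/
theorem IsRegularModulo.of_map {N P Z' : Submodule A M} {f : M →ₗ[A] M} (hN : ∀ x ∈ N, f x ∈ N)
    (hf : ∀ x ∈ P, f x ∈ Z') (hsurj : ∀ z ∈ Z', ∃ b ∈ P, z - f b ∈ N) {θ : ℕ → A} {m : ℕ}
    (hZ' : IsRegularModulo N Z' θ m) (hP : IsRegularModulo N P θ (m + 1)) :
    IsRegularModulo N (P ⊓ N.comap f) θ (m + 1) := by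
  intro r hr x hx h
  exact isCombination_of_map hN hf hsurj hZ' r (by omega) x hx.1 hx.2
    (hP r hr x hx.1 (h.mono inf_le_left))

theorem mem_span_image_Iio_iff {θ : ℕ → A} {r : ℕ} {f : A} :
    f ∈ Ideal.span (θ '' Set.Iio r) ↔ ∃ y : ℕ → A, f = ∑ a ∈ Finset.range r, θ a * y a := by
  constructor
  · intro h
    refine Submodule.span_induction
      (p := fun f _ => ∃ y : ℕ → A, f = ∑ a ∈ Finset.range r, θ a * y a) ?_ ?_ ?_ ?_ h
    · rintro _ ⟨i, hi, rfl⟩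
      exact ⟨Pi.single i 1, by simp [Pi.single_apply, Set.mem_Iio.1 hi]⟩
    · exact ⟨0, by simp⟩
    · rintro _ _ _ _ ⟨y, rfl⟩ ⟨z, rfl⟩
      exact ⟨y + z, by simp [mul_add, Finset.sum_add_distrib]⟩
    · rintro a _ _ ⟨y, rfl⟩
      exact ⟨fun i => a * y i, by
        rw [smul_eq_mul, Finset.mul_sum]; exact Finset.sum_congr rfl fun i _ => by ring⟩
  · rintro ⟨y, rfl⟩
    exact Ideal.sum_mem _ fun a ha =>
      Ideal.mul_mem_right _ _ (Ideal.subset_span ⟨a, Finset.mem_range.1 ha, rfl⟩)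

theorem mem_sup_span_image_Iio_iff {θ : ℕ → A} {r : ℕ} {f : A} {J : Ideal A} :
    f ∈ J ⊔ Ideal.span (θ '' Set.Iio r) ↔
      ∃ y : ℕ → A, f - ∑ a ∈ Finset.range r, θ a * y a ∈ J := by
  rw [Submodule.mem_sup]
  constructor
  · rintro ⟨j, hj, g, hg, rfl⟩
    obtain ⟨y, rfl⟩ := mem_span_image_Iio_iff.1 hg
    exact ⟨y, by simpa using hj⟩
  · rintro ⟨y, hy⟩
    exact ⟨_, hy, _, mem_span_image_Iio_iff.2 ⟨y, rfl⟩, by ring⟩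

end RegularSequences

/-! ### The coresolution of the face ring by coordinate rings, and regularity of generic parameters
-/

section Coresolution

variable {V : Type*} [Fintype V] [LinearOrder V]

/-- The tuples `g` of polynomials such that `g F` vanishes on the coordinate space of `F`. -/
def coordVanishing : Submodule (MvPolynomial V ℝ) (Finset V → MvPolynomial V ℝ) where
  carrier := {g | ∀ F, g F ∈ coordIdeal F}
  add_mem' := fun ha hb F => add_mem (ha F) (hb F)
  zero_mem' := fun _ => zero_mem _
  smul_mem' := fun c _ ha F => Ideal.mul_mem_left _ c (ha F)

theorem coordIdeal_anti {F G : Finset V} (h : F ⊆ G) : coordIdeal G ≤ coordIdeal F := by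
  intro f hf
  rw [mem_coordIdeal_iff] at hf ⊢
  exact fun s hs => hf s (hs.trans h)

/-- Polynomials on the coordinate space of a face restrict to smaller faces, so the boundary map
descends to the sum of the rings `A / coordIdeal F`. -/
theorem boundaryMap_mem_coordVanishing {g : Finset V → MvPolynomial V ℝ}
    (hg : g ∈ coordVanishing) : boundaryMap (MvPolynomial V ℝ) g ∈ coordVanishing := by
  intro F
  rw [boundaryMap_apply]
  refine Ideal.sum_mem _ fun v _ => ?_
  split_ifs
  · exact zero_mem _
  · exact Ideal.mul_mem_left _ _ (coordIdeal_anti (Finset.subset_insert v F) (hg _))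

/-- The component of a chain with polynomial coefficients in the multidegree `s`. -/
def coeffChain (s : V →₀ ℕ) (g : Finset V → MvPolynomial V ℝ) : Finset V → ℝ :=
  fun F => coeff s (g F)

theorem coeff_boundaryMap (s : V →₀ ℕ) (g : Finset V → MvPolynomial V ℝ) (F : Finset V) :
    coeff s (boundaryMap (MvPolynomial V ℝ) g F) = boundaryMap ℝ (coeffChain s g) F := by
  rw [boundaryMap_apply, boundaryMap_apply, coeff_sum]
  refine Finset.sum_congr rfl fun v _ => ?_
  split_ifs
  · simp
  · have : ((-1) ^ (F.filter (· < v)).card : MvPolynomial V ℝ) =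
        C ((-1) ^ (F.filter (· < v)).card) := by simp
    rw [this, coeff_C_mul, coeffChain]

theorem coeffChain_mem_chains {K : PreAbstractSimplicialComplex V} {i : ℕ}
    {g : Finset V → MvPolynomial V ℝ} (hg : g ∈ chains (MvPolynomial V ℝ) K i) (s : V →₀ ℕ) :
    coeffChain s g ∈ chains ℝ K i := by
  rw [mem_chains_iff] at hg ⊢
  exact fun F hF => hg F fun h => hF (by simp [coeffChain, h])

/-- The multidegrees that occur in a tuple of polynomials. -/
def chainSupport (g : Finset V → MvPolynomial V ℝ) : Finset (V →₀ ℕ) :=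
  Finset.univ.biUnion fun F => (g F).support

theorem coeff_eq_zero_of_notMem_chainSupport {g : Finset V → MvPolynomial V ℝ} {s : V →₀ ℕ}
    (hs : s ∉ chainSupport g) (F : Finset V) : coeff s (g F) = 0 := by
  by_contra h
  exact hs (Finset.mem_biUnion.2 ⟨F, Finset.mem_univ _, mem_support_iff.2 h⟩)

theorem coeff_sum_monomial (T : Finset (V →₀ ℕ)) (b : (V →₀ ℕ) → ℝ) (s : V →₀ ℕ) :
    coeff s (∑ t ∈ T, monomial t (b t)) = if s ∈ T then b s else 0 := by
  rw [coeff_sum]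
  simp [coeff_monomial]

/-- Chains with polynomial coefficients on faces with `i` elements that are cycles
modulo `coordVanishing`. -/
def polyCycles (K : PreAbstractSimplicialComplex V) (i : ℕ) :
    Submodule (MvPolynomial V ℝ) (Finset V → MvPolynomial V ℝ) :=
  chains (MvPolynomial V ℝ) K i ⊓ coordVanishing.comap (boundaryMap (MvPolynomial V ℝ))

theorem boundaryMap_coeffChain_eq_zero {K : PreAbstractSimplicialComplex V} {i : ℕ}
    {z : Finset V → MvPolynomial V ℝ} (hz : z ∈ polyCycles K i) (s : V →₀ ℕ) (F : Finset V)
    (hF : s.support ⊆ F) : boundaryMap ℝ (coeffChain s z) F = 0 := by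
  rw [← coeff_boundaryMap]
  exact mem_coordIdeal_iff.1 (hz.2 F) s hF

/-- Exactness is checked one multidegree `s` at a time. The monomial `s` survives on the coordinate
space of `F` exactly when `s.support ⊆ F`, so the degree `s` part is the chain complex relative to
faces not containing `s.support`. Only the finitely many multidegrees occurring in `z` are
reassembled. -/
theorem IsGorensteinStar.exists_poly_boundary {K : PreAbstractSimplicialComplex V}
    (hK : K.IsGorensteinStar ℝ) {i : ℕ} (hi : i < K.rank) {z : Finset V → MvPolynomial V ℝ}
    (hz : z ∈ polyCycles K i) :
    ∃ g ∈ chains (MvPolynomial V ℝ) K (i + 1),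
      z - boundaryMap (MvPolynomial V ℝ) g ∈ coordVanishing := by
  have h : ∀ s : V →₀ ℕ, ∃ b ∈ chains ℝ K (i + 1), ∀ F, s.support ⊆ F →
      coeffChain s z F = boundaryMap ℝ b F := by
    intro s
    by_cases hs : K.IsFace s.support
    · exact hK.exists_relative_boundary hs hi (coeffChain_mem_chains hz.1 s)
        (boundaryMap_coeffChain_eq_zero hz s)
    · refine ⟨0, zero_mem _, fun F hF => ?_⟩
      rw [map_zero, Pi.zero_apply]
      by_contra h0
      exact hs ((mem_chains_iff.1 (coeffChain_mem_chains hz.1 s) F h0).1.subset hF)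
  choose b hb hbz using h
  let g : Finset V → MvPolynomial V ℝ := fun F => ∑ s ∈ chainSupport z, monomial s (b s F)
  have hg : ∀ s, coeffChain s g = if s ∈ chainSupport z then b s else 0 := by
    intro s
    funext F
    rw [coeffChain, coeff_sum_monomial]
    split_ifs <;> rfl
  refine ⟨g, ?_, fun F => ?_⟩
  · rw [mem_chains_iff]
    intro F hF
    obtain ⟨s, -, hs⟩ := Finset.exists_ne_zero_of_sum_ne_zero hF
    exact mem_chains_iff.1 (hb s) F fun h => hs (by rw [h, map_zero])
  · rw [mem_coordIdeal_iff]
    intro s hs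
    rw [Pi.sub_apply, coeff_sub, coeff_boundaryMap, hg]
    split_ifs with h
    · rw [← hbz s F hs, coeffChain, sub_self]
    · rw [coeff_eq_zero_of_notMem_chainSupport h, map_zero, Pi.zero_apply, sub_zero]

/-- On each face with `i` elements the quotient by the earlier parameters is a domain, because the
ideal is generated by linear forms, and genericity keeps `θ r` nonzero there for `r < i`. -/
theorem isRegularModulo_chains {K : PreAbstractSimplicialComplex V} {θ : ℕ → V → ℝ}
    (hθ : ∀ r, ∀ F, K.IsFace F → r < F.card →
      θ r ∉ Submodule.span ℝ (θ '' Set.Iio r) ⊔ vanishing F) (i : ℕ) :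
    IsRegularModulo coordVanishing (chains (MvPolynomial V ℝ) K i) (fun a => linForm (θ a)) i := by
  rintro r hr x hx ⟨c, hc, hxc⟩
  have h : ∀ F, ∃ y : ℕ → MvPolynomial V ℝ, ((∃ a, y a ≠ 0) → K.IsFace F ∧ F.card = i) ∧
      x F - ∑ a ∈ Finset.range r, linForm (θ a) * y a ∈ coordIdeal F := by
    intro F
    by_cases hF : K.IsFace F ∧ F.card = i
    · have h1 : linForm (θ r) * x F ∈
          linIdeal (vanishing F ⊔ Submodule.span ℝ (θ '' Set.Iio r)) := by
        rw [linIdeal_sup, linIdeal_span, ← Set.image_comp, mem_sup_span_image_Iio_iff]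
        exact ⟨fun a => c a F, by simpa using hxc F⟩
      have h2 := mem_linIdeal_of_linForm_mul_mem
        (by rw [sup_comm]; exact hθ r F hF.1 (by omega)) h1
      rw [linIdeal_sup, linIdeal_span, ← Set.image_comp, mem_sup_span_image_Iio_iff] at h2
      obtain ⟨y, hy⟩ := h2
      exact ⟨y, fun _ => hF, hy⟩
    · refine ⟨0, by simp, ?_⟩
      have : x F = 0 := by
        by_contra h0
        exact hF (mem_chains_iff.1 hx F h0)
      simp [this]
  choose y hy hxy using h
  refine ⟨fun a F => y F a, fun a => ?_, fun F => ?_⟩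
  · rw [mem_chains_iff]
    exact fun F hF => hy F ⟨a, hF⟩
  · simpa using hxy F

/-- Induction along the exact sequences from cycles to chains to cycles with one element fewer. Each
step gains one parameter, starting from none on the empty face. -/
theorem IsGorensteinStar.isRegularModulo_polyCycles {K : PreAbstractSimplicialComplex V}
    (hK : K.IsGorensteinStar ℝ) {θ : ℕ → V → ℝ}
    (hθ : ∀ r, ∀ F, K.IsFace F → r < F.card →
      θ r ∉ Submodule.span ℝ (θ '' Set.Iio r) ⊔ vanishing F) :
    ∀ i ≤ K.rank, IsRegularModulo coordVanishing (polyCycles K i) (fun a => linForm (θ a)) i := by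
  intro i
  induction i with
  | zero => exact fun _ r hr => absurd hr (Nat.not_lt_zero _)
  | succ i ih =>
    intro hi
    refine IsRegularModulo.of_map (fun x hx => boundaryMap_mem_coordVanishing hx)
      (Z' := polyCycles K i) (fun x hx => ⟨boundaryMap_mem_chains hx, ?_⟩)
      (fun z hz => hK.exists_poly_boundary (by omega) hz) (ih (by omega))
      (isRegularModulo_chains hθ _)
    rw [Submodule.comap_coe, Set.mem_preimage, boundaryMap_boundaryMap]
    exact zero_mem _

theorem IsPure.mem_faceIdeal {K : PreAbstractSimplicialComplex V} (hK : K.IsPure)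
    {f : MvPolynomial V ℝ} (h : ∀ F, K.IsFace F → F.card = K.rank → f ∈ coordIdeal F) :
    f ∈ K.faceIdeal := by
  rw [mem_faceIdeal_iff]
  intro s hs
  obtain ⟨F, hF, hsF, hFc⟩ := hK _ hs
  exact mem_coordIdeal_iff.1 (h F hF hFc) s hsF

/-- Generic combinations of a linear system of parameters of a homology sphere form a regular
sequence on the face ring. -/
theorem IsGorensteinStar.mem_of_linForm_mul_mem {K : PreAbstractSimplicialComplex V}
    (hK : K.IsGorensteinStar ℝ) {θ : ℕ → V → ℝ}
    (hθ : ∀ r, ∀ F, K.IsFace F → r < F.card →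
      θ r ∉ Submodule.span ℝ (θ '' Set.Iio r) ⊔ vanishing F) {r : ℕ} (hr : r < K.rank)
    {f : MvPolynomial V ℝ}
    (hf : linForm (θ r) * f ∈
      K.faceIdeal ⊔ Ideal.span ((fun a => linForm (θ a)) '' Set.Iio r)) :
    f ∈ K.faceIdeal ⊔ Ideal.span ((fun a => linForm (θ a)) '' Set.Iio r) := by
  obtain ⟨μ, hμ, hμb, hμ0⟩ := hK.exists_fundamental_cycle
  -- The augmentation of the coresolution: the face ring becomes the module of top polynomial cycles
  -- by weighting with the fundamental cycle `μ`.
  let ι : MvPolynomial V ℝ → Finset V → MvPolynomial V ℝ := fun p F => C (μ F) * p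
  have hι : ∀ p, ι p ∈ polyCycles K K.rank := by
    intro p
    refine ⟨?_, fun F => ?_⟩
    · rw [SetLike.mem_coe, mem_chains_iff]
      exact fun F hF => mem_chains_iff.1 hμ F fun h => hF (by simp [ι, h])
    · rw [mem_coordIdeal_iff]
      intro s _
      have : coeffChain s (ι p) = coeff s p • μ := by
        funext F
        simp only [coeffChain, ι, coeff_C_mul, Pi.smul_apply, smul_eq_mul]
        ring
      rw [coeff_boundaryMap, this, map_smul, hμb, smul_zero, Pi.zero_apply]
  -- In multidegree `s`, the relative top cycles over `s.support` are the multiples of `μ`; the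
  -- multiplier is the coefficient of `p` at `s`.
  have hsurj : ∀ z ∈ polyCycles K K.rank, ∃ p, z - ι p ∈ coordVanishing := by
    intro z hz
    have h : ∀ s : V →₀ ℕ, ∃ l : ℝ, ∀ F, s.support ⊆ F → coeff s (z F) = l * μ F := by
      intro s
      by_cases hs : K.IsFace s.support
      · obtain ⟨F, hF, hsF, hFc⟩ := hK.1 _ hs
        exact hK.exists_relative_smul_eq hs (coeffChain_mem_chains hz.1 s)
          (boundaryMap_coeffChain_eq_zero hz s) hμ (fun F _ => by rw [hμb]; rfl)
          ⟨F, hsF, hμ0 F hF hFc⟩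
      · refine ⟨0, fun F hF => ?_⟩
        rw [zero_mul]
        by_contra h0
        exact hs ((mem_chains_iff.1 (coeffChain_mem_chains hz.1 s) F h0).1.subset hF)
    choose l hl using h
    refine ⟨∑ s ∈ chainSupport z, monomial s (l s), fun F => ?_⟩
    rw [mem_coordIdeal_iff]
    intro s hs
    rw [Pi.sub_apply, coeff_sub, coeff_C_mul, coeff_sum_monomial]
    split_ifs with h
    · rw [hl s F hs]; ring
    · rw [coeff_eq_zero_of_notMem_chainSupport h]; ring
  rw [mem_sup_span_image_Iio_iff] at hf ⊢
  obtain ⟨y, hy⟩ := hf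
  have h1 : IsCombination coordVanishing (polyCycles K K.rank) (fun a => linForm (θ a)) r
      (linForm (θ r) • ι f) := by
    refine ⟨fun a => ι (y a), fun a => hι _, fun F => ?_⟩
    by_cases hF : K.IsFace F
    · have h2 := Ideal.mul_mem_left _ (C (μ F)) (faceIdeal_le_coordIdeal hF hy)
      convert h2 using 1
      simp only [ι, Pi.sub_apply, Pi.smul_apply, Finset.sum_apply, smul_eq_mul, mul_sub,
        Finset.mul_sum]
      congr 1
      · ring
      · exact Finset.sum_congr rfl fun a _ => by ring
    · have hμF : μ F = 0 := by
        by_contra h0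
        exact hF (mem_chains_iff.1 hμ F h0).1
      simp [ι, hμF]
  obtain ⟨z, hz, hzf⟩ := hK.isRegularModulo_polyCycles hθ K.rank le_rfl r hr _ (hι f) h1
  choose p hp using fun a => hsurj (z a) (hz a)
  -- By purity membership in the face ideal can be tested on facets, where `μ F` is invertible.
  refine ⟨p, hK.1.mem_faceIdeal fun F hF hFc => ?_⟩
  have h2 : C (μ F) * (f - ∑ a ∈ Finset.range r, linForm (θ a) * p a) ∈ coordIdeal F := by
    have h3 := add_mem (hzf F) (Ideal.sum_mem (coordIdeal F) (t := Finset.range r)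
      (f := fun a => linForm (θ a) * (z a - ι (p a)) F)
      fun a _ => Ideal.mul_mem_left _ _ (hp a F))
    convert h3 using 1
    simp only [ι, Pi.sub_apply, Pi.smul_apply, Finset.sum_apply, smul_eq_mul, mul_sub,
      Finset.mul_sum, Finset.sum_sub_distrib]
    rw [sub_add_sub_cancel]
    congr 1
    exact Finset.sum_congr rfl fun a _ => by ring
  have h4 := Ideal.mul_mem_left _ (C (μ F)⁻¹) h2
  rwa [← mul_assoc, ← C_mul, inv_mul_cancel₀ (hμ0 F hF hFc), C_1, one_mul] at h4

end Coresolution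

/-! ### Hilbert series of face rings and of quotients by regular linear forms -/

section HilbertFunction

variable {V : Type*} [Fintype V]

section

attribute [local instance] MvPolynomial.gradedAlgebra

theorem homogeneousComponent_mul_of_isHomogeneous {σ : Type*} {l : MvPolynomial σ ℝ} {m : ℕ}
    (hl : l.IsHomogeneous m) (f : MvPolynomial σ ℝ) (n : ℕ) :
    homogeneousComponent (m + n) (l * f) = l * homogeneousComponent n f := by
  have h := DirectSum.coe_decompose_mul_add_of_left_mem (homogeneousSubmodule σ ℝ) (j := n)
    (b := f) ((mem_homogeneousSubmodule m l).2 hl)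
  have e : ∀ (p : MvPolynomial σ ℝ) (i : ℕ),
      (DirectSum.decompose (homogeneousSubmodule σ ℝ) p i : MvPolynomial σ ℝ) =
        homogeneousComponent i p := fun p i => decomposition.decompose'_apply p i
  rwa [e, e] at h

theorem homogeneousComponent_mem_span {σ : Type*} {s : Set (MvPolynomial σ ℝ)}
    (hs : ∀ f ∈ s, ∃ n, f.IsHomogeneous n) {f : MvPolynomial σ ℝ} (hf : f ∈ Ideal.span s) (n : ℕ) :
    homogeneousComponent n f ∈ Ideal.span s :=
  homogeneousComponent_mem_of_mem (Ideal.homogeneous_span _ s fun x hx => hs x hx) hf n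

end

/-- The degree `i` part of the quotient of the polynomial ring by `J`. -/
def quotientPart (J : Ideal (MvPolynomial V ℝ)) (i : ℕ) : Submodule ℝ (MvPolynomial V ℝ ⧸ J) :=
  (homogeneousSubmodule V ℝ i).map (Ideal.Quotient.mkₐ ℝ J).toLinearMap

instance (i : ℕ) : Module.Finite ℝ (homogeneousSubmodule V ℝ i) :=
  Module.Finite.iff_fg.2 (homogeneousSubmodule_fg V ℝ i)

instance (J : Ideal (MvPolynomial V ℝ)) (i : ℕ) : Module.Finite ℝ (quotientPart J i) :=
  Module.Finite.map _ _

theorem finrank_map_add_finrank_map {E F : Type*} [AddCommGroup E] [Module ℝ E] [AddCommGroup F]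
    [Module ℝ F] (W : Submodule ℝ E) [Module.Finite ℝ W] (f : E →ₗ[ℝ] F) {U : Submodule ℝ E}
    (hUW : U ≤ W) (hU : ∀ x ∈ W, f x = 0 ↔ x ∈ U) :
    Module.finrank ℝ (W.map f) + Module.finrank ℝ U = Module.finrank ℝ W := by
  have h := LinearMap.finrank_range_add_finrank_ker (f.domRestrict W)
  rw [LinearMap.range_domRestrict] at h
  rw [← h]
  congr 1
  have h1 : (LinearMap.ker (f.domRestrict W)).map W.subtype = U := by
    ext x
    constructor
    · rintro ⟨⟨y, hy⟩, hy0, rfl⟩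
      exact (hU y hy).1 hy0
    · intro hx
      exact ⟨⟨x, hUW hx⟩, (hU x (hUW hx)).2 hx, rfl⟩
  rw [← h1]
  exact (Submodule.equivMapOfInjective W.subtype W.injective_subtype _).finrank_eq.symm

theorem map_factor_quotientPart {J J' : Ideal (MvPolynomial V ℝ)} (h : J ≤ J') (i : ℕ) :
    (quotientPart J i).map (Ideal.Quotient.factorₐ ℝ h).toLinearMap = quotientPart J' i := by
  rw [quotientPart, quotientPart, ← Submodule.map_comp]
  rfl

/-- Dimension count in `0 → (A/J)_q → (A/J)_{q+1} → (A/(J, l))_{q+1} → 0`, with first map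
multiplication by `l`. Homogeneity of `J` allows a representation `j + a * l` of a form to be
replaced by its homogeneous component. -/
theorem finrank_quotientPart_sup_span {J : Ideal (MvPolynomial V ℝ)}
    (hJ : ∀ f ∈ J, ∀ n, homogeneousComponent n f ∈ J) {l : MvPolynomial V ℝ}
    (hl : l.IsHomogeneous 1) (hreg : ∀ f, l * f ∈ J → f ∈ J) (q : ℕ) :
    Module.finrank ℝ (quotientPart (J ⊔ Ideal.span {l}) (q + 1)) +
      Module.finrank ℝ (quotientPart J q) = Module.finrank ℝ (quotientPart J (q + 1)) := by
  let m : (MvPolynomial V ℝ ⧸ J) →ₗ[ℝ] (MvPolynomial V ℝ ⧸ J) :=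
    LinearMap.mulLeft ℝ (Ideal.Quotient.mk J l)
  have hm : Function.Injective m := by
    rw [← LinearMap.ker_eq_bot, LinearMap.ker_eq_bot']
    intro x hx
    obtain ⟨f, rfl⟩ := Ideal.Quotient.mk_surjective x
    have h1 : Ideal.Quotient.mk J (l * f) = 0 := by rw [map_mul]; exact hx
    rw [Ideal.Quotient.eq_zero_iff_mem] at h1 ⊢
    exact hreg f h1
  have h1 : Module.finrank ℝ (quotientPart J q) = Module.finrank ℝ ((quotientPart J q).map m) :=
    (Submodule.equivMapOfInjective m hm _).finrank_eq
  rw [h1, ← map_factor_quotientPart (le_sup_left : J ≤ J ⊔ Ideal.span {l})]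
  apply finrank_map_add_finrank_map
  · rintro _ ⟨_, ⟨f, hf, rfl⟩, rfl⟩
    refine ⟨l * f, ?_, map_mul (Ideal.Quotient.mk J) _ _⟩
    rw [add_comm]
    exact hl.mul hf
  · rintro _ ⟨g, hg, rfl⟩
    have hg' : g.IsHomogeneous (q + 1) := hg
    constructor
    · intro h
      have h2 : g ∈ J ⊔ Ideal.span {l} := Ideal.Quotient.eq_zero_iff_mem.1 h
      obtain ⟨j, hj, b, hb, hjb⟩ := Submodule.mem_sup.1 h2
      obtain ⟨a, rfl⟩ := Ideal.mem_span_singleton'.1 hb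
      refine ⟨_, ⟨homogeneousComponent q a, homogeneousComponent_isHomogeneous _ _, rfl⟩, ?_⟩
      have h3 : g = homogeneousComponent (q + 1) j + l * homogeneousComponent q a := by
        rw [← homogeneousComponent_eq_self hg', ← hjb, map_add, mul_comm a l, add_comm q 1,
          homogeneousComponent_mul_of_isHomogeneous hl]
      change Ideal.Quotient.mk J l * Ideal.Quotient.mk J (homogeneousComponent q a) =
        Ideal.Quotient.mk J g
      rw [h3, map_add, Ideal.Quotient.eq_zero_iff_mem.2 (hJ j hj _), zero_add, map_mul]
    · rintro ⟨_, ⟨f, -, rfl⟩, hfg⟩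
      rw [← hfg]
      change Ideal.Quotient.mk (J ⊔ Ideal.span {l}) (l * f) = 0
      rw [Ideal.Quotient.eq_zero_iff_mem]
      exact Ideal.mem_sup_right (Ideal.mul_mem_right _ _ (Ideal.mem_span_singleton_self l))

theorem finrank_quotientPart_sup_span_zero {J : Ideal (MvPolynomial V ℝ)}
    (hJ : ∀ f ∈ J, ∀ n, homogeneousComponent n f ∈ J) {l : MvPolynomial V ℝ}
    (hl : l.IsHomogeneous 1) :
    Module.finrank ℝ (quotientPart (J ⊔ Ideal.span {l}) 0) =
      Module.finrank ℝ (quotientPart J 0) := by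
  rw [← map_factor_quotientPart (le_sup_left : J ≤ J ⊔ Ideal.span {l})]
  have := finrank_map_add_finrank_map (quotientPart J 0)
    (Ideal.Quotient.factorₐ ℝ (le_sup_left : J ≤ J ⊔ Ideal.span {l})).toLinearMap
    (U := ⊥) bot_le ?_
  · simpa using this
  rintro _ ⟨g, hg, rfl⟩
  have hg' : g.IsHomogeneous 0 := hg
  constructor
  · intro h
    have h2 : g ∈ J ⊔ Ideal.span {l} := Ideal.Quotient.eq_zero_iff_mem.1 h
    obtain ⟨j, hj, b, hb, hjb⟩ := Submodule.mem_sup.1 h2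
    obtain ⟨a, rfl⟩ := Ideal.mem_span_singleton'.1 hb
    refine Ideal.Quotient.eq_zero_iff_mem.2 ?_
    have hl0 : coeff 0 l = 0 := hl.coeff_eq_zero (by simp)
    have h3 : g = homogeneousComponent 0 j := by
      rw [← homogeneousComponent_eq_self hg', ← hjb, homogeneousComponent_zero,
        homogeneousComponent_zero, coeff_add]
      have : coeff 0 (a * l) = 0 := by
        rw [← constantCoeff_eq, map_mul, constantCoeff_eq, hl0, mul_zero]
      rw [this, add_zero]
    rw [h3]
    exact hJ j hj 0
  · intro h
    rw [(Submodule.mem_bot ℝ).1 h, map_zero]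

-- On forms of degree `q`, the quotient map and the map reading off coefficients at face monomials
-- have the same kernel, so their images have the same dimension.
open Classical in
theorem finrank_quotientPart_faceIdeal (K : PreAbstractSimplicialComplex V) (q : ℕ) :
    Module.finrank ℝ (quotientPart K.faceIdeal q) =
      ((Finset.finsuppAntidiag Finset.univ q).filter
        fun s : V →₀ ℕ => K.IsFace s.support).card := by
  set B := (Finset.finsuppAntidiag Finset.univ q).filter fun s : V →₀ ℕ => K.IsFace s.support
    with hB
  have hdeg : ∀ s : V →₀ ℕ, s ∈ B ↔ s.degree = q ∧ K.IsFace s.support := by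
    intro s
    rw [hB, Finset.mem_filter, Finset.mem_finsuppAntidiag, Finsupp.degree_eq_sum]
    simp
  let φ : MvPolynomial V ℝ →ₗ[ℝ] (B → ℝ) := LinearMap.pi fun s => lcoeff ℝ s.1
  have hφ : ∀ f s, φ f s = coeff s.1 f := fun f s => rfl
  let U : Submodule ℝ (MvPolynomial V ℝ) :=
    homogeneousSubmodule V ℝ q ⊓ K.faceIdeal.restrictScalars ℝ
  have h1 := finrank_map_add_finrank_map (homogeneousSubmodule V ℝ q)
    (Ideal.Quotient.mkₐ ℝ K.faceIdeal).toLinearMap (U := U) inf_le_left (fun x hx => by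
      refine Ideal.Quotient.eq_zero_iff_mem.trans ⟨fun h => ⟨hx, h⟩, fun h => h.2⟩)
  have h2 := finrank_map_add_finrank_map (homogeneousSubmodule V ℝ q) φ (U := U) inf_le_left
    (fun x hx => by
      constructor
      · intro h
        refine ⟨hx, (mem_faceIdeal_iff K).2 fun s hs => ?_⟩
        by_cases hsd : s.degree = q
        · have := congrFun h ⟨s, (hdeg s).2 ⟨hsd, hs⟩⟩
          exact this
        · exact IsHomogeneous.coeff_eq_zero hx hsd
      · intro h
        funext s
        exact (mem_faceIdeal_iff K).1 h.2 s.1 ((hdeg _).1 s.2).2)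
  have h3 : (homogeneousSubmodule V ℝ q).map φ = ⊤ := by
    rw [eq_top_iff]
    intro y _
    refine ⟨∑ s : B, monomial s.1 (y s), ?_, ?_⟩
    · exact IsHomogeneous.sum _ _ _ fun s _ => isHomogeneous_monomial _ ((hdeg _).1 s.2).1
    · funext s
      rw [hφ, coeff_sum]
      simp [coeff_monomial]
  rw [h3, finrank_top, Module.finrank_fintype_fun_eq_card, Fintype.card_coe] at h2
  rw [quotientPart]
  omega

/-- The Hilbert series of the quotient of the polynomial ring by `J`. -/
def hilbertSeries (J : Ideal (MvPolynomial V ℝ)) : PowerSeries ℤ :=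
  PowerSeries.mk fun q => (Module.finrank ℝ (quotientPart J q) : ℤ)

theorem hilbertSeries_sup_span {J : Ideal (MvPolynomial V ℝ)}
    (hJ : ∀ f ∈ J, ∀ n, homogeneousComponent n f ∈ J) {l : MvPolynomial V ℝ}
    (hl : l.IsHomogeneous 1) (hreg : ∀ f, l * f ∈ J → f ∈ J) :
    hilbertSeries (J ⊔ Ideal.span {l}) = (1 - PowerSeries.X) * hilbertSeries J := by
  ext q
  rw [sub_mul, one_mul, map_sub]
  cases q with
  | zero =>
    rw [PowerSeries.coeff_zero_X_mul, sub_zero, hilbertSeries, hilbertSeries, PowerSeries.coeff_mk,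
      PowerSeries.coeff_mk, finrank_quotientPart_sup_span_zero hJ hl]
  | succ q =>
    rw [PowerSeries.coeff_succ_X_mul, hilbertSeries, hilbertSeries, PowerSeries.coeff_mk,
      PowerSeries.coeff_mk, PowerSeries.coeff_mk, ← finrank_quotientPart_sup_span hJ hl hreg q]
    push_cast
    ring

/-- The power series `X / (1 - X)`. -/
def geomSeries : PowerSeries ℤ := PowerSeries.mk fun n => if n = 0 then 0 else 1

theorem one_sub_X_mul_geomSeries : (1 - PowerSeries.X) * geomSeries = PowerSeries.X := by
  ext q
  rw [sub_mul, one_mul, map_sub]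
  cases q with
  | zero => simp [geomSeries]
  | succ q =>
    rw [PowerSeries.coeff_succ_X_mul, geomSeries, PowerSeries.coeff_mk, PowerSeries.coeff_mk,
      PowerSeries.coeff_X]
    rcases q with _ | q <;> simp

open Classical in
/-- The faces of a complex, the empty one included. -/
def faceFinset (K : PreAbstractSimplicialComplex V) : Finset (Finset V) :=
  Finset.univ.filter fun F => K.IsFace F

theorem mem_faceFinset {K : PreAbstractSimplicialComplex V} {F : Finset V} :
    F ∈ K.faceFinset ↔ K.IsFace F := by
  simp [faceFinset]

/-- Sort the surviving monomials by support: those with support exactly `F` have a positive exponent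
at each vertex of `F`, and are counted by `(X / (1 - X)) ^ F.card`. -/
theorem hilbertSeries_faceIdeal (K : PreAbstractSimplicialComplex V) :
    hilbertSeries K.faceIdeal = ∑ F ∈ K.faceFinset, geomSeries ^ F.card := by
  classical
  ext q
  rw [hilbertSeries, PowerSeries.coeff_mk, finrank_quotientPart_faceIdeal, map_sum,
    Finset.card_eq_sum_card_fiberwise (f := Finsupp.support) (t := K.faceFinset)
      (fun s hs => mem_faceFinset.2 (Finset.mem_filter.1 hs).2)]
  push_cast
  refine Finset.sum_congr rfl fun F hF => ?_
  rw [← Finset.prod_const, PowerSeries.coeff_prod]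
  have h : ∀ l : V →₀ ℕ, ∏ i ∈ F, PowerSeries.coeff (l i) geomSeries =
      if ∀ i ∈ F, l i ≠ 0 then (1 : ℤ) else 0 := by
    intro l
    simp only [geomSeries, PowerSeries.coeff_mk]
    split_ifs with hl
    · exact Finset.prod_eq_one fun i hi => if_neg (hl i hi)
    · push Not at hl
      obtain ⟨i, hi, h0⟩ := hl
      exact Finset.prod_eq_zero hi (if_pos h0)
  rw [Finset.sum_congr rfl fun l _ => h l, Finset.sum_boole]
  norm_cast
  congr 1
  ext s
  simp only [Finset.mem_filter, Finset.mem_finsuppAntidiag, Finset.subset_univ, and_true]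
  have hsum : s.support ⊆ F → ∑ i, s i = ∑ i ∈ F, s i := by
    intro hs
    refine (Finset.sum_subset (Finset.subset_univ F) fun i _ hi => ?_).symm
    by_contra h0
    exact hi (hs (Finsupp.mem_support_iff.2 h0))
  constructor
  · rintro ⟨⟨h1, h2⟩, rfl⟩
    exact ⟨⟨by rw [← hsum subset_rfl]; exact h1, subset_rfl⟩,
      fun i hi => Finsupp.mem_support_iff.1 hi⟩
  · rintro ⟨⟨h1, h2⟩, h3⟩
    have h4 : s.support = F :=
      Finset.Subset.antisymm h2 fun i hi => Finsupp.mem_support_iff.2 (h3 i hi)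
    exact ⟨⟨by rw [hsum h2]; exact h1, by rw [h4]; exact mem_faceFinset.1 hF⟩, h4⟩

end HilbertFunction

/-! ### Euler characteristics of links and symmetry of the h-polynomial -/

section DehnSommerville

variable {V : Type*} [Fintype V] [LinearOrder V]

theorem finrank_chains (K : PreAbstractSimplicialComplex V) (p : ℕ) :
    Module.finrank ℝ (chains ℝ K p) = (K.faceFinset.filter fun F => F.card = p).card := by
  classical
  have h1 : chains ℝ K p = Submodule.span ℝ
      (((K.faceFinset.filter fun F => F.card = p).image
        fun F => (Pi.single F 1 : Finset V → ℝ)) : Set (Finset V → ℝ)) := by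
    rw [chains, Finset.coe_image]
    congr 2
    ext F
    simp [mem_faceFinset]
  have hinj : Function.Injective fun F => (Pi.single F 1 : Finset V → ℝ) := by
    intro F G h
    by_contra hne
    have := congrFun h F
    simp [hne] at this
  rw [h1, finrank_span_finset_eq_card, Finset.card_image_of_injective _ hinj]
  have h2 : LinearIndependent ℝ fun F => (Pi.single F 1 : Finset V → ℝ) := by
    have := (Pi.basisFun ℝ (Finset V)).linearIndependent
    convert this using 1
    funext F
    simp
  rw [Finset.coe_image]
  exact (h2.linearIndepOn (s := _)).id_image

/-- The Euler characteristic of a homology sphere. -/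
theorem HasSphereHomology.sum_neg_one_pow_card {K : PreAbstractSimplicialComplex V}
    (hK : K.HasSphereHomology ℝ) : ∑ F ∈ K.faceFinset, (-1 : ℤ) ^ F.card = (-1) ^ K.rank := by
  let f : ℕ → ℕ := fun p => Module.finrank ℝ (chains ℝ K p)
  let z : ℕ → ℕ := fun p => Module.finrank ℝ (cycles ℝ K p)
  let b : ℕ → ℕ := fun p => Module.finrank ℝ (boundaries ℝ K p)
  have hsucc : ∀ p, b p + z (p + 1) = f (p + 1) := fun p =>
    finrank_map_add_finrank_map (chains ℝ K (p + 1)) (boundaryMap ℝ) (U := cycles ℝ K (p + 1))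
      inf_le_left fun x hx => ⟨fun h => ⟨hx, h⟩, fun h => h.2⟩
  have hzero : z 0 = f 0 := by
    have : cycles ℝ K 0 = chains ℝ K 0 := by
      refine inf_eq_left.2 fun c hc => ?_
      rw [LinearMap.mem_ker]
      funext F
      rw [boundaryMap_apply]
      refine Finset.sum_eq_zero fun v _ => ?_
      split_ifs
      · rfl
      · have : c (insert v F) = 0 := by
          by_contra h0
          have := (mem_chains_iff.1 hc _ h0).2
          simp at this
        rw [this, mul_zero]
    change Module.finrank ℝ (cycles ℝ K 0) = Module.finrank ℝ (chains ℝ K 0)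
    rw [this]
  have hbz : ∀ p < K.rank, b p = z p := by
    intro p hp
    have : boundaries ℝ K p = cycles ℝ K p := by
      refine le_antisymm (boundaries_le_cycles K p) fun c hc => ?_
      obtain ⟨x, hx, hxc⟩ := exists_boundary_of_subsingleton (hK.1 p hp.ne) hc
      exact ⟨x, hx, hxc⟩
    change Module.finrank ℝ (boundaries ℝ K p) = Module.finrank ℝ (cycles ℝ K p)
    rw [this]
  -- Each chain space splits numerically into cycles and their boundaries; below the top degree
  -- boundaries fill the cycles and the alternating sum telescopes.
  have hsum : ∀ m ≤ K.rank, ∑ p ∈ Finset.range (m + 1), (-1 : ℤ) ^ p * f p = (-1) ^ m * z m := by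
    intro m
    induction m with
    | zero => intro _; simp [hzero]
    | succ m ih =>
      intro hm
      rw [Finset.sum_range_succ, ih (by omega), ← hsucc m, hbz m (by omega)]
      push_cast
      ring
  have h1 := hsum K.rank le_rfl
  have h2 : z K.rank = 1 := finrank_cycles_rank hK
  rw [h2, Nat.cast_one, mul_one] at h1
  rw [← h1, ← Finset.sum_fiberwise_of_maps_to (s := K.faceFinset) (g := Finset.card)
    (t := Finset.range (K.rank + 1))
    (fun F hF => Finset.mem_range.2 (Nat.lt_succ_of_le (mem_faceFinset.1 hF).card_le_rank))]
  refine Finset.sum_congr rfl fun p _ => ?_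
  rw [Finset.sum_congr rfl fun F hF => by rw [(Finset.mem_filter.1 hF).2], Finset.sum_const]
  simp only [f, finrank_chains]
  rw [nsmul_eq_mul, mul_comm]

theorem IsGorensteinStar.sum_neg_one_pow_card {K : PreAbstractSimplicialComplex V}
    (hK : K.IsGorensteinStar ℝ) {G : Finset V} (hG : K.IsFace G) :
    ∑ F ∈ K.faceFinset.filter (G ⊆ ·), (-1 : ℤ) ^ (K.rank - F.card) = 1 := by
  have h1 := (hK.2 G hG).sum_neg_one_pow_card
  have hr := rank_link hK.1 hG
  have hsq : ∀ n : ℕ, (-1 : ℤ) ^ n * (-1) ^ n = 1 := fun n => by rw [← mul_pow]; simp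
  have h2 : ∑ F ∈ K.faceFinset.filter (G ⊆ ·), (-1 : ℤ) ^ (K.rank - F.card) =
      ∑ L ∈ (K.link G).faceFinset, (-1 : ℤ) ^ (K.link G).rank * (-1) ^ L.card := by
    refine Finset.sum_nbij' (fun F => F \ G) (fun L => L ∪ G) ?_ ?_ ?_ ?_ ?_
    · intro F hF
      rw [Finset.mem_filter, mem_faceFinset] at hF
      rw [mem_faceFinset, isFace_link_iff hG]
      exact ⟨Finset.sdiff_disjoint, by rw [Finset.sdiff_union_of_subset hF.2]; exact hF.1⟩
    · intro L hL
      rw [mem_faceFinset, isFace_link_iff hG] at hL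
      rw [Finset.mem_filter, mem_faceFinset]
      exact ⟨hL.2, Finset.subset_union_right⟩
    · intro F hF
      exact Finset.sdiff_union_of_subset (Finset.mem_filter.1 hF).2
    · intro L hL
      rw [mem_faceFinset, isFace_link_iff hG] at hL
      exact Finset.union_sdiff_cancel_right hL.1
    · intro F hF
      rw [Finset.mem_filter, mem_faceFinset] at hF
      rw [Finset.card_sdiff_of_subset hF.2]
      have h3 := hF.1.card_le_rank
      have h4 := Finset.card_le_card hF.2
      rw [← hr]
      have h5 : (K.link G).rank = ((K.link G).rank + G.card - F.card) + (F.card - G.card) := by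
        omega
      conv_rhs => rw [h5, pow_add, mul_assoc, hsq, mul_one]
  rw [h2, ← Finset.mul_sum, h1, hsq]

/-- Multiply each term on the left by the Euler sum `1` over the faces above `G`, exchange the
summations, and apply the binomial theorem to the subsets `G` of a fixed `F`. -/
theorem IsGorensteinStar.sum_X_pow_mul_eq {K : PreAbstractSimplicialComplex V}
    (hK : K.IsGorensteinStar ℝ) :
    ∑ G ∈ K.faceFinset, (Polynomial.X : Polynomial ℤ) ^ G.card * (1 - Polynomial.X) ^ (K.rank - G.card) =
      ∑ F ∈ K.faceFinset, (Polynomial.X - 1 : Polynomial ℤ) ^ (K.rank - F.card) := by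
  have h1 : ∀ G ∈ K.faceFinset, (Polynomial.X : Polynomial ℤ) ^ G.card * (1 - Polynomial.X) ^ (K.rank - G.card) =
      ∑ F ∈ K.faceFinset, if G ⊆ F then
        (-1) ^ (K.rank - F.card) * ((Polynomial.X : Polynomial ℤ) ^ G.card * (1 - Polynomial.X) ^ (K.rank - G.card)) else 0 := by
    intro G hG
    rw [← Finset.sum_filter, ← Finset.sum_mul]
    have h := congrArg (Int.cast : ℤ → Polynomial ℤ) (hK.sum_neg_one_pow_card (mem_faceFinset.1 hG))
    push_cast at h
    rw [h, one_mul]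
  rw [Finset.sum_congr rfl h1, Finset.sum_comm]
  refine Finset.sum_congr rfl fun F hF => ?_
  rw [← Finset.sum_filter]
  have h2 : K.faceFinset.filter (· ⊆ F) = F.powerset := by
    ext G
    rw [Finset.mem_filter, mem_faceFinset, Finset.mem_powerset]
    exact ⟨fun h => h.2, fun h => ⟨(mem_faceFinset.1 hF).subset h, h⟩⟩
  rw [h2]
  have h3 : ∀ G ∈ F.powerset,
      (-1) ^ (K.rank - F.card) * ((Polynomial.X : Polynomial ℤ) ^ G.card * (1 - Polynomial.X) ^ (K.rank - G.card)) =
      (Polynomial.X - 1) ^ (K.rank - F.card) * (Polynomial.X ^ G.card * (1 - Polynomial.X) ^ (F.card - G.card)) := by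
    intro G hG
    have h4 := Finset.card_le_card (Finset.mem_powerset.1 hG)
    have h5 := (mem_faceFinset.1 hF).card_le_rank
    have h6 : K.rank - G.card = (K.rank - F.card) + (F.card - G.card) := by omega
    have h7 : (Polynomial.X - 1 : Polynomial ℤ) = -1 * (1 - Polynomial.X) := by ring
    rw [h6, pow_add, h7, mul_pow]
    ring
  rw [Finset.sum_congr rfl h3, ← Finset.mul_sum, Finset.sum_pow_mul_eq_add_pow]
  simp

/-- Substituting `1/X` and multiplying by `X ^ d` turns `X ^ g (1 - X) ^ (d-g)` into `(X - 1) ^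
(d-g)`. With `sum_X_pow_mul_eq` this makes the h-polynomial equal to its reversal. -/
theorem coeff_X_pow_mul_one_sub_X_pow {d g q : ℕ} (hg : g ≤ d) (hq : q ≤ d) :
    ((Polynomial.X : Polynomial ℤ) ^ g * (1 - Polynomial.X) ^ (d - g)).coeff q = ((Polynomial.X - 1 : Polynomial ℤ) ^ (d - g)).coeff (d - q) := by
  have h1 : (1 - Polynomial.X : Polynomial ℤ) ^ (d - g) = Polynomial.C ((-1) ^ (d - g)) * (Polynomial.X + Polynomial.C (-1)) ^ (d - g) := by
    rw [Polynomial.C_pow, ← mul_pow]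
    congr 1
    simp [sub_eq_add_neg, add_comm]
  have h2 : (Polynomial.X - 1 : Polynomial ℤ) = Polynomial.X + Polynomial.C (-1) := by simp [sub_eq_add_neg]
  rw [Polynomial.coeff_X_pow_mul', h1, h2, Polynomial.coeff_C_mul, Polynomial.coeff_X_add_C_pow, Polynomial.coeff_X_add_C_pow]
  split_ifs with h
  · obtain ⟨m, rfl⟩ := Nat.exists_eq_add_of_le h
    obtain ⟨e, rfl⟩ := Nat.exists_eq_add_of_le hq
    have e1 : g + m + e - g = m + e := by omega
    have e2 : g + m + e - (g + m) = e := by omega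
    have e3 : g + m - g = m := by omega
    rw [e1, e2, e3, Nat.add_sub_cancel, Nat.add_sub_cancel_left,
      Nat.choose_symm_add (a := m) (b := e), pow_add]
    have : (-1 : ℤ) ^ e * (-1) ^ e = 1 := by rw [← mul_pow]; simp
    linear_combination ((-1 : ℤ) ^ m * ((m + e).choose e : ℤ)) * this
  · rw [Nat.choose_eq_zero_of_lt (by omega)]
    simp

theorem IsGorensteinStar.hilbertSeries_eq {K : PreAbstractSimplicialComplex V}
    (hK : K.IsGorensteinStar ℝ) {Θ : Fin K.rank → MvPolynomial V ℝ} (hΘ : K.IsLSOP Θ) :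
    hilbertSeries (K.reductionIdeal Θ) =
      (∑ G ∈ K.faceFinset, (Polynomial.X : Polynomial ℤ) ^ G.card *
        (1 - Polynomial.X) ^ (K.rank - G.card) : Polynomial ℤ) := by
  choose t ht using fun a => exists_linForm_eq (hΘ.1 a)
  obtain rfl : (fun a => linForm (t a)) = Θ := funext ht
  obtain ⟨θ, hθT, hθ⟩ := exists_generic_parameters hΘ.2
  -- The generic parameters are divided out one at a time, each contributing a factor `1 - X`. As
  -- they have the same span as the given l.s.o.p., the last ideal is the original reduction ideal.
  let J : ℕ → Ideal (MvPolynomial V ℝ) := fun r =>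
    K.faceIdeal ⊔ Ideal.span ((fun a => linForm (θ a)) '' Set.Iio r)
  have hJhom : ∀ r, ∀ f ∈ J r, ∀ n, homogeneousComponent n f ∈ J r := by
    intro r f hf n
    simp only [J, faceIdeal, ← Ideal.span_union] at hf ⊢
    refine homogeneousComponent_mem_span ?_ hf n
    rintro g (⟨s, -, rfl⟩ | ⟨a, -, rfl⟩)
    · exact ⟨_, isHomogeneous_monomial _ rfl⟩
    · exact ⟨1, isHomogeneous_linForm _⟩
  have hJsucc : ∀ r, J (r + 1) = J r ⊔ Ideal.span {linForm (θ r)} := by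
    intro r
    have : Set.Iio (r + 1) = Set.Iio r ∪ {r} := by
      ext i; simp only [Set.mem_Iio, Set.mem_union, Set.mem_singleton_iff]; omega
    simp only [J]
    rw [this, Set.image_union, Ideal.span_union, Set.image_singleton, sup_assoc]
  have hJ0 : J 0 = K.faceIdeal := by simp [J]
  have hJd : J K.rank = K.reductionIdeal fun a => linForm (t a) := by
    simp only [J, reductionIdeal]
    congr 1
    rw [← Function.comp_def, Set.image_comp, ← linIdeal_span, hθT, linIdeal_span, ← Set.range_comp]
    rfl
  have hH : ∀ r ≤ K.rank, hilbertSeries (J r) =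
      (1 - PowerSeries.X) ^ r * hilbertSeries K.faceIdeal := by
    intro r
    induction r with
    | zero => intro _; rw [hJ0, pow_zero, one_mul]
    | succ r ih =>
      intro hr
      rw [hJsucc, hilbertSeries_sup_span (hJhom r) (isHomogeneous_linForm _)
        (fun f hf => hK.mem_of_linForm_mul_mem hθ (by omega) hf), ih (by omega), pow_succ]
      ring
  rw [← hJd, hH _ le_rfl, hilbertSeries_faceIdeal, Finset.mul_sum]
  rw [← Polynomial.coeToPowerSeries.ringHom_apply, map_sum]
  refine Finset.sum_congr rfl fun G hG => ?_
  have h1 := (mem_faceFinset.1 hG).card_le_rank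
  rw [map_mul, map_pow, map_pow, map_sub, map_one]
  simp only [Polynomial.coeToPowerSeries.ringHom_apply, Polynomial.coe_X]
  have h2 : K.rank = (K.rank - G.card) + G.card := by omega
  conv_lhs => rw [h2, pow_add, mul_assoc, ← mul_pow, one_sub_X_mul_geomSeries]
  rw [mul_comm]

/-- The Dehn–Sommerville relations for the reduction of the face ring of a homology sphere. -/
theorem IsGorensteinStar.finrank_gradedPart_eq {K : PreAbstractSimplicialComplex V}
    (hK : K.IsGorensteinStar ℝ) {Θ : Fin K.rank → MvPolynomial V ℝ} (hΘ : K.IsLSOP Θ) {q : ℕ}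
    (hq : q ≤ K.rank) : Module.finrank ℝ (K.gradedPart Θ q) =
      Module.finrank ℝ (K.gradedPart Θ (K.rank - q)) := by
  have h1 : ∀ i, (Module.finrank ℝ (K.gradedPart Θ i) : ℤ) =
      (∑ G ∈ K.faceFinset, (Polynomial.X : Polynomial ℤ) ^ G.card *
        (1 - Polynomial.X) ^ (K.rank - G.card) : Polynomial ℤ).coeff i := by
    intro i
    rw [← Polynomial.coeff_coe, ← hK.hilbertSeries_eq hΘ, hilbertSeries, PowerSeries.coeff_mk]
    rfl
  zify
  rw [h1, h1, Polynomial.finsetSum_coeff, hK.sum_X_pow_mul_eq, Polynomial.finsetSum_coeff]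
  exact Finset.sum_congr rfl fun G hG =>
    coeff_X_pow_mul_one_sub_X_pow (mem_faceFinset.1 hG).card_le_rank hq

end DehnSommerville

/-! ### Genericity of Lefschetz elements -/

section Lefschetz

theorem exists_polynomial_eval_eq_det {n : ℕ} {m : Type*} [Fintype m] [DecidableEq m]
    (M : ℕ → Matrix m m ℝ) :
    ∃ P : Polynomial ℝ, ∀ s : ℝ, P.eval s = (∑ i ∈ Finset.range n, s ^ i • M i).det := by
  refine ⟨(∑ i ∈ Finset.range n, (Polynomial.X : Polynomial ℝ) ^ i •
    (M i).map Polynomial.C).det, fun s => ?_⟩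
  rw [← Polynomial.coe_evalRingHom, RingHom.map_det]
  congr 1
  ext a b
  simp only [RingHom.mapMatrix_apply, Matrix.map_apply, Matrix.sum_apply, Matrix.smul_apply,
    smul_eq_mul, map_sum, Polynomial.coe_evalRingHom, Polynomial.eval_mul, Polynomial.eval_pow,
    Polynomial.eval_X, Polynomial.eval_C]

/-- After composition with the inverse of the isomorphism at `s₀`, the determinant is a polynomial
in `s` with value `1` at `s₀`, so it has finitely many roots. -/
theorem finite_setOf_not_bijective {E F : Type*} [AddCommGroup E] [Module ℝ E]
    [Module.Finite ℝ E] [AddCommGroup F] [Module ℝ F] {n : ℕ} (L : ℕ → E →ₗ[ℝ] F) {s₀ : ℝ}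
    (h : Function.Bijective (∑ i ∈ Finset.range n, s₀ ^ i • L i : E →ₗ[ℝ] F)) :
    {s : ℝ | ¬ Function.Bijective (∑ i ∈ Finset.range n, s ^ i • L i : E →ₗ[ℝ] F)}.Finite := by
  classical
  let e : E ≃ₗ[ℝ] F := LinearEquiv.ofBijective _ h
  let b := Module.finBasis ℝ E
  let T : ℝ → E →ₗ[ℝ] E := fun s => e.symm.toLinearMap ∘ₗ (∑ i ∈ Finset.range n, s ^ i • L i)
  obtain ⟨P, hP⟩ := exists_polynomial_eval_eq_det (n := n)
    fun i => LinearMap.toMatrix b b (e.symm.toLinearMap ∘ₗ L i)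
  have hT : ∀ s, P.eval s = LinearMap.det (T s) := by
    intro s
    rw [hP, ← LinearMap.det_toMatrix b]
    congr 1
    simp only [T]
    rw [← LinearMap.compRight_apply ℝ, map_sum, map_sum]
    refine Finset.sum_congr rfl fun i _ => ?_
    rw [map_smul, map_smul, LinearMap.compRight_apply]
  have h0 : P ≠ 0 := by
    rintro rfl
    have h1 := hT s₀
    have h2 : T s₀ = LinearMap.id := by
      ext x
      exact e.symm_apply_apply x
    rw [h2, LinearMap.det_id] at h1
    simp at h1
  refine (Polynomial.finite_setOfPred_isRoot h0).subset fun s hs => ?_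
  by_contra hroot
  apply hs
  have h1 : LinearMap.det (T s) ≠ 0 := by rw [← hT]; exact hroot
  have h2 : Function.Bijective (T s) :=
    (LinearEquiv.ofIsUnitDet (f := T s) (v := b) (v' := b)
      (by rw [LinearMap.det_toMatrix]; exact h1.isUnit)).bijective
  have h3 : ⇑(∑ i ∈ Finset.range n, s ^ i • L i : E →ₗ[ℝ] F) = e ∘ T s := by
    funext x
    exact (e.apply_symm_apply _).symm
  rw [h3]
  exact e.bijective.comp h2

variable {V ι : Type*} [Fintype V]

theorem bijOn_iff_bijective_restrict {M : Type*} [AddCommGroup M] [Module ℝ M]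
    {P Q : Submodule ℝ M} {f : M → M} {g : P →ₗ[ℝ] Q} (h : ∀ x, (g x : M) = f x) :
    Set.BijOn f P Q ↔ Function.Bijective g := by
  constructor
  · rintro ⟨-, hinj, hsurj⟩
    refine ⟨fun x y hxy => ?_, fun y => ?_⟩
    · exact Subtype.ext (hinj x.2 y.2 (by rw [← h, ← h, hxy]))
    · obtain ⟨x, hx, hxy⟩ := hsurj y.2
      exact ⟨⟨x, hx⟩, Subtype.ext (by rw [h]; exact hxy)⟩
  · rintro ⟨hinj, hsurj⟩
    refine ⟨fun x hx => ?_, fun x hx y hy hxy => ?_, fun y hy => ?_⟩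
    · rw [← h ⟨x, hx⟩]; exact (g ⟨x, hx⟩).2
    · have : g ⟨x, hx⟩ = g ⟨y, hy⟩ := Subtype.ext (by rw [h, h]; exact hxy)
      exact congrArg Subtype.val (hinj this)
    · obtain ⟨x, hx⟩ := hsurj ⟨y, hy⟩
      exact ⟨x, x.2, by rw [← h, hx]⟩

theorem mulBy_mem_gradedPart (K : PreAbstractSimplicialComplex V) (Θ : ι → MvPolynomial V ℝ)
    {f : MvPolynomial V ℝ} {m : ℕ} (hf : f.IsHomogeneous m) {i : ℕ} {x : K.ReducedRing Θ}
    (hx : x ∈ K.gradedPart Θ i) : K.mulBy Θ f x ∈ K.gradedPart Θ (m + i) := by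
  obtain ⟨g, hg, rfl⟩ := hx
  exact ⟨f * g, hf.mul hg, map_mul (Ideal.Quotient.mk (K.reductionIdeal Θ)) _ _⟩

instance (K : PreAbstractSimplicialComplex V) (Θ : ι → MvPolynomial V ℝ) (i : ℕ) :
    Module.Finite ℝ (K.gradedPart Θ i) :=
  inferInstanceAs (Module.Finite ℝ (quotientPart (K.reductionIdeal Θ) i))

/-- Multiplication by a form, as a linear map between graded parts. -/
def mulGraded (K : PreAbstractSimplicialComplex V) (Θ : ι → MvPolynomial V ℝ)
    {f : MvPolynomial V ℝ} {m : ℕ} (hf : f.IsHomogeneous m) {i j : ℕ} (hj : m + i = j) :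
    K.gradedPart Θ i →ₗ[ℝ] K.gradedPart Θ j :=
  (LinearMap.mulLeft ℝ (Ideal.Quotient.mk (K.reductionIdeal Θ) f)).restrict
    fun _ hx => hj ▸ mulBy_mem_gradedPart K Θ hf hx

theorem coe_mulGraded (K : PreAbstractSimplicialComplex V) (Θ : ι → MvPolynomial V ℝ)
    {f : MvPolynomial V ℝ} {m : ℕ} (hf : f.IsHomogeneous m) {i j : ℕ} (hj : m + i = j)
    (x : K.gradedPart Θ i) : (K.mulGraded Θ hf hj x : K.ReducedRing Θ) = K.mulBy Θ f x := rfl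

/-- Being a Lefschetz element is an open condition on lines. -/
theorem finite_setOf_not_isLefschetzElement (K : PreAbstractSimplicialComplex V)
    (Θ : ι → MvPolynomial V ℝ) {i : ℕ} (hi : 2 * i ≤ K.rank) {ω η : MvPolynomial V ℝ}
    (hω : ω.IsHomogeneous 1) (hη : η.IsHomogeneous 1) {s₀ : ℝ}
    (h : K.IsLefschetzElement Θ i (ω + s₀ • η)) :
    {s : ℝ | ¬ K.IsLefschetzElement Θ i (ω + s • η)}.Finite := by
  set m := K.rank - 2 * i with hm
  have hhom : ∀ s : ℝ, (ω + s • η).IsHomogeneous 1 := fun s => by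
    rw [smul_eq_C_mul]; exact hω.add (hη.C_mul s)
  -- `L a` is the coefficient of `s ^ a` in the binomial expansion of `(ω + s • η) ^ m`. The value
  -- `0` beyond `m` never enters the sum.
  let L : ℕ → K.gradedPart Θ i →ₗ[ℝ] K.gradedPart Θ (K.rank - i) := fun a =>
    if ha : a ≤ m then K.mulGraded Θ (f := (m.choose a : ℝ) • (ω ^ (m - a) * η ^ a)) (m := m)
      (by
        rw [smul_eq_C_mul]
        have h1 := ((hω.pow (m - a)).mul (hη.pow a)).C_mul (m.choose a : ℝ)
        have h2 : 1 * (m - a) + 1 * a = m := by omega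
        rwa [h2] at h1) (by omega)
    else 0
  have hL : ∀ s : ℝ, ∀ x : K.gradedPart Θ i,
      ((∑ a ∈ Finset.range (m + 1), s ^ a • L a :
        K.gradedPart Θ i →ₗ[ℝ] K.gradedPart Θ (K.rank - i)) x : K.ReducedRing Θ) =
        K.mulBy Θ ((ω + s • η) ^ m) x := by
    intro s x
    rw [LinearMap.sum_apply, Submodule.coe_sum, mulBy, add_comm ω, add_pow, map_sum,
      Finset.sum_mul]
    refine Finset.sum_congr rfl fun a ha => ?_
    have ha' : a ≤ m := Nat.lt_succ_iff.1 (Finset.mem_range.1 ha)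
    simp only [L, dif_pos ha', LinearMap.smul_apply, Submodule.coe_smul, coe_mulGraded, mulBy]
    rw [← smul_mul_assoc]
    congr 1
    rw [← Ideal.Quotient.mkₐ_eq_mk ℝ, ← map_smul]
    congr 1
    simp only [smul_eq_C_mul, map_natCast, map_pow]
    ring
  have hiff : ∀ s : ℝ, K.IsLefschetzElement Θ i (ω + s • η) ↔
      Function.Bijective (∑ a ∈ Finset.range (m + 1), s ^ a • L a :
        K.gradedPart Θ i →ₗ[ℝ] K.gradedPart Θ (K.rank - i)) := fun s =>
    (and_iff_right (hhom s)).trans (bijOn_iff_bijective_restrict (hL s))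
  simp only [hiff] at h ⊢
  exact finite_setOf_not_bijective L h

/-- Finitely many Lefschetz properties that hold separately hold for a common element. -/
theorem exists_common_lefschetzElement (K : PreAbstractSimplicialComplex V)
    (Θ : ι → MvPolynomial V ℝ) (T : Finset ℕ) (hT : ∀ i ∈ T, 2 * i ≤ K.rank)
    (h : ∀ i ∈ T, K.IsLefschetz Θ i) :
    ∃ ω : MvPolynomial V ℝ, ω.IsHomogeneous 1 ∧ ∀ i ∈ T, K.IsLefschetzElement Θ i ω := by
  induction T using Finset.induction_on with
  | empty => exact ⟨0, isHomogeneous_zero _ _ _, by simp⟩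
  | insert j T _ ih =>
    obtain ⟨ω, hω, hωT⟩ := ih (fun i hi => hT i (Finset.mem_insert_of_mem hi))
      fun i hi => h i (Finset.mem_insert_of_mem hi)
    obtain ⟨η, hη⟩ := h j (Finset.mem_insert_self _ _)
    have hδ : (η - ω).IsHomogeneous 1 := hη.1.sub hω
    have hfin : (⋃ i ∈ insert j T,
        {s : ℝ | ¬ K.IsLefschetzElement Θ i (ω + s • (η - ω))}).Finite := by
      refine (Finset.finite_toSet _).biUnion fun i hi => ?_
      -- The line passes through `η` at `s = 1` and through `ω` at `s = 0`, so each condition holds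
      -- somewhere on it and fails only finitely often.
      rcases Finset.mem_insert.1 hi with rfl | hi'
      · exact finite_setOf_not_isLefschetzElement K Θ (hT _ hi) hω hδ (s₀ := 1) (by simpa using hη)
      · exact finite_setOf_not_isLefschetzElement K Θ (hT _ hi) hω hδ (s₀ := 0)
          (by simpa using hωT i hi')
    obtain ⟨s, hs⟩ := hfin.exists_notMem
    simp only [Set.mem_iUnion, Set.mem_ofPred_eq, not_exists, not_not] at hs
    refine ⟨ω + s • (η - ω), ?_, fun i hi => hs i hi⟩
    exact (hs j (Finset.mem_insert_self _ _)).1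

/-- In the middle degree `2 * i = K.rank` the Lefschetz map is the identity, so the failure must
occur strictly below it. -/
theorem exists_not_isLefschetz_of_not_isHL (K : PreAbstractSimplicialComplex V)
    (Θ : ι → MvPolynomial V ℝ) (h : ¬ K.IsHL Θ) : ∃ i, 2 * i < K.rank ∧ ¬ K.IsLefschetz Θ i := by
  by_contra! hc
  apply h
  obtain ⟨ω, hω, hωT⟩ := exists_common_lefschetzElement K Θ
    ((Finset.range K.rank).filter fun i => 2 * i < K.rank)
    (fun i hi => (Finset.mem_filter.1 hi).2.le) fun i hi => hc i (Finset.mem_filter.1 hi).2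
  refine ⟨ω, fun i hi => ?_⟩
  rcases hi.lt_or_eq with h1 | h1
  · exact hωT i (Finset.mem_filter.2 ⟨Finset.mem_range.2 (by omega), h1⟩)
  · refine ⟨hω, ?_⟩
    have h2 : K.rank - i = i := by omega
    have h3 : K.mulBy Θ (ω ^ (K.rank - 2 * i)) = id := by
      funext x
      simp [mulBy, h1]
    rw [h2, h3]
    exact Set.bijOn_id _

end Lefschetz

/-! ### The reduction of a join with the boundary of a simplex -/

section Join

variable {V W : Type*}

theorem isFace_join_iff {K : PreAbstractSimplicialComplex V} {L : PreAbstractSimplicialComplex W}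
    {F : Finset (V ⊕ W)} : (K.join L).IsFace F ↔ K.IsFace F.toLeft ∧ L.IsFace F.toRight := by
  constructor
  · rintro (rfl | ⟨-, h1, h2⟩)
    · exact ⟨Or.inl rfl, Or.inl rfl⟩
    · exact ⟨h1, h2⟩
  · rintro ⟨h1, h2⟩
    rcases Finset.eq_empty_or_nonempty F with h | h
    · exact Or.inl h
    · exact Or.inr ⟨h, h1, h2⟩

theorem rank_join [Fintype V] [Fintype W] (K : PreAbstractSimplicialComplex V)
    (L : PreAbstractSimplicialComplex W) : (K.join L).rank = K.rank + L.rank := by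
  apply le_antisymm
  · obtain ⟨F, hF, hFc⟩ := exists_isFace_card_eq_rank (K.join L)
    rw [isFace_join_iff] at hF
    rw [← hFc, ← Finset.card_toLeft_add_card_toRight]
    exact add_le_add hF.1.card_le_rank hF.2.card_le_rank
  · obtain ⟨F, hF, hFc⟩ := exists_isFace_card_eq_rank K
    obtain ⟨G, hG, hGc⟩ := exists_isFace_card_eq_rank L
    have : (K.join L).IsFace (F.disjSum G) := by
      rw [isFace_join_iff, Finset.toLeft_disjSum, Finset.toRight_disjSum]
      exact ⟨hF, hG⟩
    rw [← hFc, ← hGc, ← Finset.card_disjSum]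
    exact this.card_le_rank

theorem isFace_simplexBoundary_iff [Fintype W] [Nonempty W] {F : Finset W} :
    (simplexBoundary W).IsFace F ↔ F ≠ Finset.univ := by
  constructor
  · rintro (rfl | ⟨-, h⟩)
    · exact Finset.univ_nonempty.ne_empty.symm
    · exact h
  · intro h
    rcases Finset.eq_empty_or_nonempty F with h0 | h0
    · exact Or.inl h0
    · exact Or.inr ⟨h0, h⟩

theorem rank_simplexBoundary [Fintype W] [Nonempty W] :
    (simplexBoundary W).rank + 1 = Fintype.card W := by
  classical
  apply le_antisymm
  · obtain ⟨F, hF, hFc⟩ := exists_isFace_card_eq_rank (simplexBoundary W)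
    rw [← hFc]
    exact (Finset.card_lt_iff_ne_univ F).2 (isFace_simplexBoundary_iff.1 hF)
  · obtain ⟨w⟩ := ‹Nonempty W›
    have : (simplexBoundary W).IsFace (Finset.univ.erase w) :=
      isFace_simplexBoundary_iff.2 (Finset.erase_ssubset (Finset.mem_univ w)).ne
    have h1 := this.card_le_rank
    rw [Finset.card_erase_of_mem (Finset.mem_univ w), Finset.card_univ] at h1
    omega

/-- The linear relation between the classes of the variables in the reduction of the face ring of
the boundary of a simplex. -/
theorem exists_coefficients_simplexBoundary [Fintype W] [Nonempty W]
    {u : Fin (simplexBoundary W).rank → W → ℝ}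
    (hfin : Module.Finite ℝ ((simplexBoundary W).ReducedRing fun a => linForm (u a))) :
    ∃ c : W → ℝ, (∀ w, c w ≠ 0) ∧
      ∀ a, ∑ w, a w * c w = 0 ↔ a ∈ Submodule.span ℝ (Set.range u) := by
  classical
  set U := Submodule.span ℝ (Set.range u) with hU
  have hlt : U < ⊤ := by
    rw [lt_top_iff_ne_top]
    intro h
    have h1 : Module.finrank ℝ U ≤ (simplexBoundary W).rank :=
      (finrank_range_le_card u).trans (by simp)
    rw [h, finrank_top, Module.finrank_fintype_fun_eq_card, ← rank_simplexBoundary] at h1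
    omega
  -- The vector `c` lists the values of a functional killing the l.s.o.p. on the coordinate vectors.
  -- Each facet of `∂σ` omits one vertex `w`, so `U` and the coordinate vector at `w` span
  -- everything; a zero value there would make the functional zero.
  obtain ⟨f, hf0, hf⟩ := Submodule.exists_le_ker_of_lt_top U hlt
  have hfa : ∀ a, f a = ∑ w, a w * f (Pi.single w 1) := fun a => by
    conv_lhs => rw [pi_eq_sum_univ' a, map_sum]
    refine Finset.sum_congr rfl fun w _ => ?_
    rw [map_smul, smul_eq_mul]
  have htop : ∀ w, U ⊔ vanishing (Finset.univ.erase w) = ⊤ := fun w =>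
    sup_vanishing_eq_top hfin (isFace_simplexBoundary_iff.2
      (Finset.erase_ssubset (Finset.mem_univ w)).ne)
  have hfv : ∀ w, ∀ e ∈ vanishing (Finset.univ.erase w), f e = e w * f (Pi.single w 1) := by
    intro w e he
    rw [hfa, Finset.sum_eq_single w]
    · intro v _ hv
      rw [mem_vanishing.1 he v (Finset.mem_erase.2 ⟨hv, Finset.mem_univ _⟩), zero_mul]
    · simp
  have hc : ∀ w, f (Pi.single w 1) ≠ 0 := by
    intro w h0
    apply hf0
    rw [← LinearMap.ker_eq_top, eq_top_iff, ← htop w]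
    refine sup_le hf fun e he => ?_
    rw [LinearMap.mem_ker, hfv w e he, h0, mul_zero]
  refine ⟨fun w => f (Pi.single w 1), hc, fun a => ?_⟩
  rw [← hfa]
  refine ⟨fun ha => ?_, fun ha => hf ha⟩
  obtain ⟨w⟩ := ‹Nonempty W›
  have h1 : a ∈ U ⊔ vanishing (Finset.univ.erase w) := htop w ▸ Submodule.mem_top
  obtain ⟨τ, hτ, e, he, rfl⟩ := Submodule.mem_sup.1 h1
  rw [map_add, LinearMap.mem_ker.1 (hf hτ), zero_add, hfv w e he] at ha
  have hew := (mul_eq_zero.1 ha).resolve_right (hc w)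
  have he0 : e = 0 := by
    funext v
    by_cases hv : v = w
    · rw [hv, hew]; rfl
    · exact mem_vanishing.1 he v (Finset.mem_erase.2 ⟨hv, Finset.mem_univ _⟩)
  rw [he0, add_zero]
  exact hτ

theorem prod_X_mem_faceIdeal {K : PreAbstractSimplicialComplex V} {F : Finset V}
    (hF : ¬ K.IsFace F) : ∏ v ∈ F, (X v : MvPolynomial V ℝ) ∈ K.faceIdeal := by
  classical
  refine Ideal.subset_span ⟨∑ v ∈ F, Finsupp.single v 1, ?_, ?_⟩
  · have : (∑ v ∈ F, Finsupp.single v 1 : V →₀ ℕ).support = F := by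
      ext v
      simp [Finsupp.finsetSum_apply, Finsupp.single_apply]
    rwa [this]
  · rw [monomial_sum_index, C_1, one_mul]
    rfl

theorem prod_X_dvd_monomial (s : V →₀ ℕ) :
    ∏ v ∈ s.support, (X v : MvPolynomial V ℝ) ∣ monomial s 1 := by
  rw [monomial_eq, C_1, one_mul, Finsupp.prod]
  exact Finset.prod_dvd_prod_of_dvd _ _ fun v hv =>
    dvd_pow_self _ (Finsupp.mem_support_iff.1 hv)

theorem faceIdeal_le_iff {K : PreAbstractSimplicialComplex V} {I : Ideal (MvPolynomial V ℝ)} :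
    K.faceIdeal ≤ I ↔ ∀ F, ¬ K.IsFace F → ∏ v ∈ F, (X v : MvPolynomial V ℝ) ∈ I := by
  refine ⟨fun h F hF => h (prod_X_mem_faceIdeal hF), fun h => Ideal.span_le.2 ?_⟩
  rintro _ ⟨s, hs, rfl⟩
  exact I.mem_of_dvd (prod_X_dvd_monomial s) (h _ hs)

theorem rename_inl_mem_reductionIdeal {ι κ : Type*} (K : PreAbstractSimplicialComplex V)
    (L : PreAbstractSimplicialComplex W) (Θ : ι → MvPolynomial V ℝ) (Θ' : κ → MvPolynomial W ℝ)
    {f : MvPolynomial V ℝ} (hf : f ∈ K.reductionIdeal Θ) :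
    rename Sum.inl f ∈ (K.join L).reductionIdeal (unionForms Θ Θ') := by
  classical
  suffices K.reductionIdeal Θ ≤ ((K.join L).reductionIdeal (unionForms Θ Θ')).comap
    (rename Sum.inl : MvPolynomial V ℝ →ₐ[ℝ] MvPolynomial (V ⊕ W) ℝ) from this hf
  refine sup_le (faceIdeal_le_iff.2 fun F hF => ?_) (Ideal.span_le.2 ?_)
  · rw [Ideal.mem_comap, map_prod]
    refine Ideal.mem_sup_left ?_
    have h : ¬ (K.join L).IsFace (F.disjSum ∅) := by
      rw [isFace_join_iff, Finset.toLeft_disjSum]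
      exact fun h => hF h.1
    have := prod_X_mem_faceIdeal h
    rw [Finset.prod_disjSum, Finset.prod_empty, mul_one] at this
    simpa using this
  · rintro _ ⟨a, rfl⟩
    exact Ideal.mem_sup_right (Ideal.subset_span ⟨Sum.inl a, rfl⟩)

/-- The homomorphism to a polynomial ring given by a homomorphism on the first set of variables
and by multiples of the variable on the second set. -/
def joinHom {R : Type*} [CommRing R] [Algebra ℝ R] (π : MvPolynomial V ℝ →ₐ[ℝ] R) (c : W → ℝ) :
    MvPolynomial (V ⊕ W) ℝ →ₐ[ℝ] Polynomial R :=
  aeval (Sum.elim (fun v => Polynomial.C (π (X v))) fun w => c w • Polynomial.X)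

theorem joinHom_rename_inl {R : Type*} [CommRing R] [Algebra ℝ R] (π : MvPolynomial V ℝ →ₐ[ℝ] R)
    (c : W → ℝ) (f : MvPolynomial V ℝ) :
    joinHom π c (rename Sum.inl f) = Polynomial.C (π f) := by
  have : (joinHom π c).comp (rename Sum.inl) = (Polynomial.CAlgHom (R := ℝ)).comp π := by
    apply MvPolynomial.algHom_ext
    intro v
    rw [AlgHom.comp_apply, rename_X, joinHom, aeval_X]
    rfl
  exact AlgHom.congr_fun this f

theorem joinHom_rename_inr_linForm {R : Type*} [CommRing R] [Algebra ℝ R] [Fintype W]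
    (π : MvPolynomial V ℝ →ₐ[ℝ] R) (c : W → ℝ) (a : W → ℝ) :
    joinHom π c (rename Sum.inr (linForm a)) =
      (∑ w, a w * c w) • (Polynomial.X : Polynomial R) := by
  rw [linForm_apply, map_sum, map_sum, Finset.sum_smul]
  refine Finset.sum_congr rfl fun w _ => ?_
  rw [map_smul, map_smul, rename_X, mul_smul, joinHom, aeval_X, Sum.elim_inr]

/-- The only nonface of `∂σ` is the full vertex set, whose product of variables goes to a multiple
of `X ^ Fintype.card W`; the generators coming from `K`, and the parameters on both sides, go to
`0`. -/
theorem coeff_joinHom_eq_zero {R : Type*} [CommRing R] [Algebra ℝ R] [Fintype W] [Nonempty W]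
    {π : MvPolynomial V ℝ →ₐ[ℝ] R} {c : W → ℝ} {ι κ : Type*} {K : PreAbstractSimplicialComplex V}
    {Θ : ι → MvPolynomial V ℝ} {u : κ → W → ℝ} (hπ : ∀ f ∈ K.reductionIdeal Θ, π f = 0)
    (hu : ∀ b, ∑ w, u b w * c w = 0) {f : MvPolynomial (V ⊕ W) ℝ}
    (hf : f ∈ (K.join (simplexBoundary W)).reductionIdeal
      (unionForms Θ fun b => linForm (u b))) :
    ∀ i < Fintype.card W, (joinHom π c f).coeff i = 0 := by
  classical
  rw [← Polynomial.X_pow_dvd_iff, ← Ideal.mem_span_singleton]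
  suffices (K.join (simplexBoundary W)).reductionIdeal (unionForms Θ fun b => linForm (u b)) ≤
    (Ideal.span {(Polynomial.X : Polynomial R) ^ Fintype.card W}).comap (joinHom π c) from this hf
  refine sup_le (faceIdeal_le_iff.2 fun F hF => ?_) (Ideal.span_le.2 ?_)
  · rw [Ideal.mem_comap, ← Finset.toLeft_disjSum_toRight (u := F), Finset.prod_disjSum, map_mul]
    rw [isFace_join_iff, isFace_simplexBoundary_iff, not_and_or, not_not] at hF
    rcases hF with hF | hF
    · refine Ideal.mul_mem_right _ _ ?_
      have h1 : ∏ v ∈ F.toLeft, (X (Sum.inl v) : MvPolynomial (V ⊕ W) ℝ) =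
          rename Sum.inl (∏ v ∈ F.toLeft, X v) := by simp
      rw [h1, joinHom_rename_inl, hπ _ (Ideal.mem_sup_left (prod_X_mem_faceIdeal hF)),
        Polynomial.C_0]
      exact zero_mem _
    · refine Ideal.mul_mem_left _ _ ?_
      rw [hF, map_prod]
      have h1 : ∀ w, joinHom π c (X (Sum.inr w)) = c w • Polynomial.X := fun w => by
        rw [joinHom, aeval_X, Sum.elim_inr]
      rw [Finset.prod_congr rfl fun w _ => h1 w, Finset.prod_smul, Finset.prod_const,
        Finset.card_univ, Algebra.smul_def]
      exact Ideal.mul_mem_left _ _ (Ideal.mem_span_singleton_self _)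
  · rintro _ ⟨a | b, rfl⟩
    · change joinHom π c (rename Sum.inl (Θ a)) ∈ Ideal.span {Polynomial.X ^ Fintype.card W}
      rw [joinHom_rename_inl, hπ _ (Ideal.mem_sup_right (Ideal.subset_span ⟨a, rfl⟩)),
        Polynomial.C_0]
      exact zero_mem _
    · change joinHom π c (rename Sum.inr (linForm (u b))) ∈
        Ideal.span {Polynomial.X ^ Fintype.card W}
      rw [joinHom_rename_inr_linForm, hu b, zero_smul]
      exact zero_mem _

/-- The reduction of the face ring of `K * ∂σ` contains the truncated polynomial ring in one
variable over the reduction of the face ring of `K`, and each linear form is the sum of a linear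
form of `K` and a multiple of the variable. -/
theorem exists_join_simplexBoundary_structure [Fintype V] [Fintype W] [Nonempty W] {ι : Type*}
    (K : PreAbstractSimplicialComplex V) (Θ : ι → MvPolynomial V ℝ)
    {Θ' : Fin (simplexBoundary W).rank → MvPolynomial W ℝ} (hΘ' : (simplexBoundary W).IsLSOP Θ') :
    ∃ (p : K.ReducedRing Θ →+* (K.join (simplexBoundary W)).ReducedRing (unionForms Θ Θ'))
      (t : (K.join (simplexBoundary W)).ReducedRing (unionForms Θ Θ')),
      t ^ Fintype.card W = 0 ∧
      (∀ h : ℕ → K.ReducedRing Θ, ∑ a ∈ Finset.range (Fintype.card W), p (h a) * t ^ a = 0 →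
        ∀ a < Fintype.card W, h a = 0) ∧
      (∀ i, ∀ x ∈ K.gradedPart Θ i, ∀ a, p x * t ^ a ∈
        (K.join (simplexBoundary W)).gradedPart (unionForms Θ Θ') (i + a)) ∧
      ∀ ω : MvPolynomial (V ⊕ W) ℝ, ω.IsHomogeneous 1 → ∃ (η : MvPolynomial V ℝ) (γ : ℝ),
        η.IsHomogeneous 1 ∧ Ideal.Quotient.mk _ ω =
          p (Ideal.Quotient.mk _ η) + p (algebraMap ℝ _ γ) * t := by
  classical
  choose u hu using fun a => exists_linForm_eq (hΘ'.1 a)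
  obtain rfl : (fun a => linForm (u a)) = Θ' := funext hu
  obtain ⟨c, hc, hcU⟩ := exists_coefficients_simplexBoundary hΘ'.2
  set Θ' : Fin (simplexBoundary W).rank → MvPolynomial W ℝ := fun a => linForm (u a) with hΘ'def
  set J := (K.join (simplexBoundary W)).reductionIdeal (unionForms Θ Θ') with hJ
  let p : K.ReducedRing Θ →+* (K.join (simplexBoundary W)).ReducedRing (unionForms Θ Θ') :=
    Ideal.Quotient.lift (K.reductionIdeal Θ)
      ((Ideal.Quotient.mk J).comp (rename Sum.inl : MvPolynomial V ℝ →ₐ[ℝ] _).toRingHom)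
      fun f hf => Ideal.Quotient.eq_zero_iff_mem.2
        (rename_inl_mem_reductionIdeal K _ Θ Θ' hf)
  have hp : ∀ f, p (Ideal.Quotient.mk _ f) = Ideal.Quotient.mk J (rename Sum.inl f) := fun f => rfl
  obtain ⟨w₀⟩ := id ‹Nonempty W›
  -- The scaling makes every variable `w` of the simplex equal to `c w` times the class of `T`; the
  -- product of all these variables is zero, which gives `t ^ Fintype.card W = 0`.
  let T : MvPolynomial (V ⊕ W) ℝ := C (c w₀)⁻¹ * X (Sum.inr w₀)
  have hT : T.IsHomogeneous 1 := isHomogeneous_C_mul_X _ _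
  have hTlin : T = rename Sum.inr (linForm (Pi.single w₀ (c w₀)⁻¹)) := by
    have : (Pi.single w₀ (c w₀)⁻¹ : W → ℝ) = (c w₀)⁻¹ • Pi.single w₀ 1 := by
      rw [← Pi.single_smul]; simp
    rw [this, map_smul, linForm_single, smul_eq_C_mul, map_mul, rename_C, rename_X]
  have hker : ∀ a : W → ℝ, ∑ w, a w * c w = 0 → rename Sum.inr (linForm a) ∈ J := by
    intro a ha
    have h1 := (hcU a).1 ha
    refine Submodule.span_induction (p := fun a _ => rename Sum.inr (linForm a) ∈ J)
      ?_ ?_ ?_ ?_ h1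
    · rintro _ ⟨b, rfl⟩
      exact Ideal.mem_sup_right (Ideal.subset_span ⟨Sum.inr b, rfl⟩)
    · simp
    · intro x y _ _ hx hy; rw [map_add, map_add]; exact add_mem hx hy
    · intro r x _ hx
      rw [map_smul, map_smul, smul_eq_C_mul]; exact Ideal.mul_mem_left _ _ hx
  have hlin : ∀ a : W → ℝ, Ideal.Quotient.mk J (rename Sum.inr (linForm a)) =
      Ideal.Quotient.mk J (C (∑ w, a w * c w) * T) := by
    intro a
    have h1 := hker (a - Pi.single w₀ ((∑ w, a w * c w) * (c w₀)⁻¹)) (by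
      simp only [Pi.sub_apply, sub_mul, Finset.sum_sub_distrib]
      rw [Finset.sum_eq_single (f := fun w => Pi.single (M := fun _ => ℝ) w₀
        ((∑ w, a w * c w) * (c w₀)⁻¹) w * c w) w₀ (fun w _ hw => by simp [hw]) (by simp)]
      rw [Pi.single_eq_same, mul_assoc, inv_mul_cancel₀ (hc w₀), mul_one, sub_self])
    rw [map_sub, map_sub] at h1
    rw [Ideal.Quotient.eq]
    have h2 : (Pi.single w₀ ((∑ w, a w * c w) * (c w₀)⁻¹) : W → ℝ) =
        (∑ w, a w * c w) • Pi.single w₀ (c w₀)⁻¹ := by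
      rw [← Pi.single_smul, smul_eq_mul]
    rwa [h2, map_smul, map_smul, ← hTlin, smul_eq_C_mul] at h1
  -- Since `Ψ` sends `T` to `X`, it reads off the coefficients of a polynomial in `t` below the
  -- truncation, which proves their uniqueness.
  let Ψ : MvPolynomial (V ⊕ W) ℝ →ₐ[ℝ] Polynomial (K.ReducedRing Θ) :=
    joinHom (Ideal.Quotient.mkₐ ℝ (K.reductionIdeal Θ)) c
  have hΨl : ∀ f, Ψ (rename Sum.inl f) = Polynomial.C (Ideal.Quotient.mk _ f) :=
    joinHom_rename_inl _ c
  have hΨr : ∀ a : W → ℝ, Ψ (rename Sum.inr (linForm a)) =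
      (∑ w, a w * c w) • (Polynomial.X : Polynomial (K.ReducedRing Θ)) :=
    joinHom_rename_inr_linForm _ c
  have hΨJ : ∀ f ∈ J, ∀ i < Fintype.card W, (Ψ f).coeff i = 0 := fun f hf =>
    coeff_joinHom_eq_zero (fun g hg => Ideal.Quotient.eq_zero_iff_mem.2 hg)
      (fun b => (hcU _).2 (Submodule.subset_span ⟨b, rfl⟩)) hf
  have hΨT : Ψ T = Polynomial.X := by
    rw [hTlin, hΨr, Finset.sum_eq_single w₀ (fun w _ hw => by simp [hw]) (by simp),
      Pi.single_eq_same, inv_mul_cancel₀ (hc w₀), one_smul]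
  refine ⟨p, Ideal.Quotient.mk J T, ?_, ?_, ?_, ?_⟩
  · have hnf : ¬ (K.join (simplexBoundary W)).IsFace ((∅ : Finset V).disjSum Finset.univ) := by
      rw [isFace_join_iff, Finset.toRight_disjSum, isFace_simplexBoundary_iff]
      exact fun h => h.2 rfl
    have h1 : Ideal.Quotient.mk J (∏ w : W, X (Sum.inr w)) = 0 := by
      have := prod_X_mem_faceIdeal hnf
      rw [Finset.prod_disjSum, Finset.prod_empty, one_mul] at this
      exact Ideal.Quotient.eq_zero_iff_mem.2 (Ideal.mem_sup_left this)
    have h2 : ∀ w : W, Ideal.Quotient.mk J (X (Sum.inr w)) = Ideal.Quotient.mk J (C (c w) * T) := by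
      intro w
      have := hlin (Pi.single w 1)
      rw [linForm_single, rename_X, Finset.sum_eq_single w (fun v _ hv => by simp [hv]) (by simp),
        Pi.single_eq_same, one_mul] at this
      exact this
    rw [map_prod, Finset.prod_congr rfl fun w _ => h2 w, ← map_prod, Finset.prod_mul_distrib,
      Finset.prod_const, Finset.card_univ, ← map_prod, map_mul, map_pow] at h1
    have h3 : ∏ w, c w ≠ 0 := Finset.prod_ne_zero_iff.2 fun w _ => hc w
    have h4 := congrArg (Ideal.Quotient.mk J (C (∏ w, c w)⁻¹) * ·) h1
    simp only at h4
    rwa [mul_zero, ← mul_assoc, ← map_mul, ← C_mul, inv_mul_cancel₀ h3, C_1, map_one,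
      one_mul] at h4
  · intro h hsum a ha
    choose f hf using fun a => Ideal.Quotient.mk_surjective (h a)
    have h1 : Ideal.Quotient.mk J (∑ a ∈ Finset.range (Fintype.card W),
        rename Sum.inl (f a) * T ^ a) = 0 := by
      rw [map_sum, ← hsum]
      refine Finset.sum_congr rfl fun a _ => ?_
      rw [map_mul, map_pow, ← hf, hp]
    have h3 := hΨJ _ (Ideal.Quotient.eq_zero_iff_mem.1 h1) a ha
    simp only [map_sum, map_mul, map_pow, hΨT, hΨl, hf] at h3
    rw [Polynomial.finsetSum_coeff] at h3
    simpa [Polynomial.coeff_C_mul, Polynomial.coeff_X_pow, ha] using h3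
  · rintro i _ ⟨f, hf, rfl⟩ a
    refine ⟨rename Sum.inl f * T ^ a, ?_, ?_⟩
    · have h1 := (IsHomogeneous.rename_isHomogeneous (f := (Sum.inl : V → V ⊕ W)) hf).mul (hT.pow a)
      rwa [one_mul] at h1
    · change Ideal.Quotient.mk J (rename Sum.inl f * T ^ a) = _
      rw [map_mul, map_pow, ← hp]
      rfl
  · intro ω hω
    obtain ⟨a, rfl⟩ := exists_linForm_eq hω
    refine ⟨linForm fun v => a (Sum.inl v), ∑ w, a (Sum.inr w) * c w, isHomogeneous_linForm _, ?_⟩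
    have h1 : linForm a = rename Sum.inl (linForm fun v => a (Sum.inl v)) +
        rename Sum.inr (linForm fun w => a (Sum.inr w)) := by
      simp only [linForm_apply, map_sum, map_smul, rename_X, Fintype.sum_sum_type]
    have h2 : algebraMap ℝ (K.ReducedRing Θ) (∑ w, a (Sum.inr w) * c w) =
        Ideal.Quotient.mk _ (C (∑ w, a (Sum.inr w) * c w)) := rfl
    rw [h1, map_add, hlin, map_mul, h2, hp, hp, rename_C]

/-- Injectivity of multiplication by a linear form in a truncated polynomial extension. -/
theorem eq_zero_of_injective_truncated {R Q : Type*} [CommRing R] [Algebra ℝ R] [CommRing Q]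
    (p : R →+* Q) {t : Q} {n : ℕ} (hn : 0 < n) (ht : t ^ n = 0)
    (hind : ∀ h : ℕ → R, ∑ a ∈ Finset.range n, p (h a) * t ^ a = 0 → ∀ a < n, h a = 0)
    {η x : R} {γ : ℝ} (hx : η ^ n * x = 0)
    (hinj : ∀ h : ℕ → ℝ, (p η + p (algebraMap ℝ R γ) * t) *
      ∑ a ∈ Finset.range n, p (algebraMap ℝ R (h a) * η ^ (n - 1 - a) * x) * t ^ a = 0 →
        ∑ a ∈ Finset.range n, p (algebraMap ℝ R (h a) * η ^ (n - 1 - a) * x) * t ^ a = 0) :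
    x = 0 := by
  -- Without a `t` component, the test elements `η ^ (n-1-m) x t ^ m` lower the power of `η` that
  -- kills `x` one step at a time.
  by_cases hγ : γ = 0
  · suffices ∀ m ≤ n, η ^ (n - m) * x = 0 by simpa using this n le_rfl
    intro m
    induction m with
    | zero => intro _; simpa using hx
    | succ m ih =>
      intro hm
      have ih' := ih (by omega)
      have hsum : ∑ a ∈ Finset.range n,
          p (algebraMap ℝ R (if a = m then 1 else 0) * η ^ (n - 1 - a) * x) * t ^ a =
            p (η ^ (n - 1 - m) * x) * t ^ m := by
        rw [Finset.sum_eq_single m]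
        · simp
        · intro a _ ha; simp [ha]
        · intro h; exact absurd (Finset.mem_range.2 (by omega)) h
      have h1 := hind _ (hinj (fun a => if a = m then 1 else 0) (by
        rw [hsum, hγ, map_zero, map_zero, zero_mul, add_zero, ← mul_assoc, ← map_mul, ← mul_assoc,
          ← pow_succ']
        rw [show n - 1 - m + 1 = n - m by omega, ih', map_zero, zero_mul])) m (by omega)
      rw [if_pos rfl, map_one, one_mul] at h1
      rwa [show n - (m + 1) = n - 1 - m by omega]
  -- For `γ ≠ 0` the test element is the cofactor of `γ t - (-η)` in `(γ t) ^ n - (-η) ^ n`, applied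
  -- to `x`; its coefficient at `t ^ (n-1)` is `γ ^ (n-1) x`.
  · have hsum : ∑ a ∈ Finset.range n,
        p (algebraMap ℝ R (γ ^ a * (-1) ^ (n - 1 - a)) * η ^ (n - 1 - a) * x) * t ^ a =
        (∑ a ∈ Finset.range n, (p (algebraMap ℝ R γ) * t) ^ a * (- p η) ^ (n - 1 - a)) * p x := by
      rw [Finset.sum_mul]
      refine Finset.sum_congr rfl fun a _ => ?_
      rw [neg_pow (p η)]
      simp only [map_mul, map_pow, map_neg, map_one]
      ring
    have h1 := hind _ (hinj (fun a => γ ^ a * (-1) ^ (n - 1 - a)) (by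
      rw [hsum, ← mul_assoc, mul_comm (p η + _)]
      have h2 : p η + p (algebraMap ℝ R γ) * t = p (algebraMap ℝ R γ) * t - - p η := by ring
      rw [h2, (Commute.all _ _).geom_sum₂_mul, mul_pow, ht, mul_zero, zero_sub, neg_pow (p η),
        neg_mul, mul_assoc, ← map_pow, ← map_mul, hx, map_zero, mul_zero, neg_zero])) (n - 1)
        (by omega)
    simp only [Nat.sub_self, pow_zero, mul_one] at h1
    have h3 := congrArg (algebraMap ℝ R (γ ^ (n - 1))⁻¹ * ·) h1
    rwa [mul_zero, ← mul_assoc, ← map_mul, inv_mul_cancel₀ (pow_ne_zero _ hγ), map_one,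
      one_mul] at h3

/-- If a linear form acts injectively on the middle degree of the reduction of `K * ∂σ`, then the
reduction of `K` has a linear form with the corresponding injectivity property. -/
theorem exists_injOn_of_injOn_join [Fintype V] [Fintype W] [Nonempty W] {ι : Type*}
    (K : PreAbstractSimplicialComplex V) (Θ : ι → MvPolynomial V ℝ)
    {Θ' : Fin (simplexBoundary W).rank → MvPolynomial W ℝ} (hΘ' : (simplexBoundary W).IsLSOP Θ')
    {k j : ℕ} (hj : k + Fintype.card W = j + 1) {ω : MvPolynomial (V ⊕ W) ℝ}
    (hω : ω.IsHomogeneous 1)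
    (hinj : Set.InjOn ((K.join (simplexBoundary W)).mulBy (unionForms Θ Θ') ω)
      ((K.join (simplexBoundary W)).gradedPart (unionForms Θ Θ') j)) :
    ∃ η : MvPolynomial V ℝ, η.IsHomogeneous 1 ∧
      ∀ x ∈ K.gradedPart Θ k, K.mulBy Θ (η ^ Fintype.card W) x = 0 → x = 0 := by
  obtain ⟨p, t, ht, hind, hgr, hlin⟩ := exists_join_simplexBoundary_structure K Θ hΘ'
  obtain ⟨η, γ, hη, hωη⟩ := hlin ω hω
  refine ⟨η, hη, fun x hx hx0 => ?_⟩
  refine eq_zero_of_injective_truncated p Fintype.card_pos ht hind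
    (η := Ideal.Quotient.mk _ η) (γ := γ) (by rw [← map_pow]; exact hx0) fun h h0 => ?_
  rw [← hωη] at h0
  refine hinj ?_ (Submodule.zero_mem _) (h0.trans (mul_zero _).symm)
  refine Submodule.sum_mem _ fun a ha => ?_
  have ha' := Finset.mem_range.1 ha
  have h1 : algebraMap ℝ (K.ReducedRing Θ) (h a) * Ideal.Quotient.mk _ η ^ (Fintype.card W - 1 - a)
      * x ∈ K.gradedPart Θ (1 * (Fintype.card W - 1 - a) + k) := by
    rw [mul_assoc, ← Algebra.smul_def, ← map_pow]
    exact Submodule.smul_mem _ _ (mulBy_mem_gradedPart K Θ (hη.pow _) hx)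
  have h2 := hgr _ _ h1 a
  have h3 : 1 * (Fintype.card W - 1 - a) + k + a = j := by omega
  rwa [h3] at h2

/-- By the Dehn–Sommerville relations source and target have equal dimension, so injectivity
suffices. -/
theorem IsGorensteinStar.isLefschetz_of_injOn {V : Type*} [Fintype V] [LinearOrder V]
    {K : PreAbstractSimplicialComplex V}
    (hK : K.IsGorensteinStar ℝ) {Θ : Fin K.rank → MvPolynomial V ℝ} (hΘ : K.IsLSOP Θ) {k : ℕ}
    (hk : 2 * k ≤ K.rank) {η : MvPolynomial V ℝ} (hη : η.IsHomogeneous 1)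
    (h : ∀ x ∈ K.gradedPart Θ k, K.mulBy Θ (η ^ (K.rank - 2 * k)) x = 0 → x = 0) :
    K.IsLefschetz Θ k := by
  refine ⟨η, hη, (bijOn_iff_bijective_restrict (g := K.mulGraded Θ (hη.pow (K.rank - 2 * k))
    (i := k) (j := K.rank - k) (by omega)) (coe_mulGraded K Θ _ _)).2 ?_⟩
  have hinj : Function.Injective (K.mulGraded Θ (hη.pow (K.rank - 2 * k))
      (i := k) (j := K.rank - k) (by omega)) := by
    rw [← LinearMap.ker_eq_bot, LinearMap.ker_eq_bot']
    intro x hx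
    exact Subtype.ext (h x x.2 (congrArg Subtype.val hx))
  exact ⟨hinj, (LinearMap.injective_iff_surjective_of_finrank_eq_finrank
    (hK.finrank_gradedPart_eq hΘ (by omega))).1 hinj⟩

end Join

end PreAbstractSimplicialComplex

end

/-! ### The choice of the simplex and the conclusion -/

theorem mainTheorem7 {V : Type*} [Fintype V] [LinearOrder V]
    (S : PreAbstractSimplicialComplex V) (hS : S.IsGorensteinStar ℝ)
    (ΘS : Fin S.rank → MvPolynomial V ℝ) (hΘS : S.IsLSOP ΘS)
    (hmid : S.IsLefschetz ΘS (S.rank / 2)) (hHL : ¬ S.IsHL ΘS) :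
    ∃ n j : ℕ, 0 < n ∧
      (S.join (PreAbstractSimplicialComplex.simplexBoundary (Fin n))).dim = 2 * (j : ℤ) ∧
      ∀ Θσ : Fin (PreAbstractSimplicialComplex.simplexBoundary (Fin n)).rank →
          MvPolynomial (Fin n) ℝ,
        (PreAbstractSimplicialComplex.simplexBoundary (Fin n)).IsLSOP Θσ →
        (¬ ∃ ω, (S.join (PreAbstractSimplicialComplex.simplexBoundary (Fin n))).IsLefschetzElement
            (PreAbstractSimplicialComplex.unionForms ΘS Θσ) j ω) ∧
        ¬ (S.join (PreAbstractSimplicialComplex.simplexBoundary (Fin n))).IsUnimodalWL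
            (PreAbstractSimplicialComplex.unionForms ΘS Θσ) := by
  obtain ⟨k, hk, hnot⟩ :=
    PreAbstractSimplicialComplex.exists_not_isLefschetz_of_not_isHL S ΘS hHL
  have hn : 0 < S.rank - 2 * k := by omega
  have : Nonempty (Fin (S.rank - 2 * k)) := ⟨⟨0, hn⟩⟩
  have hrσ := PreAbstractSimplicialComplex.rank_simplexBoundary (W := Fin (S.rank - 2 * k))
  rw [Fintype.card_fin] at hrσ
  have hrank := PreAbstractSimplicialComplex.rank_join S
    (PreAbstractSimplicialComplex.simplexBoundary (Fin (S.rank - 2 * k)))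
  -- With `d - 2k` vertices the join has rank `d + (d - 2k - 1) = 2j + 1` for `j = d - k - 1`, and
  -- `k + n = j + 1` matches degree `k` of `S` with degree `j` of the join.
  refine ⟨S.rank - 2 * k, S.rank - k - 1, hn, ?_, fun Θσ hΘσ => ?_⟩
  · rw [PreAbstractSimplicialComplex.dim]
    omega
  have key : ∀ ω : MvPolynomial (V ⊕ Fin (S.rank - 2 * k)) ℝ, ω.IsHomogeneous 1 →
      ¬ Set.InjOn ((S.join (PreAbstractSimplicialComplex.simplexBoundary _)).mulBy
        (PreAbstractSimplicialComplex.unionForms ΘS Θσ) ω)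
        ((S.join (PreAbstractSimplicialComplex.simplexBoundary _)).gradedPart
          (PreAbstractSimplicialComplex.unionForms ΘS Θσ) (S.rank - k - 1)) := by
    intro ω hω hinj
    obtain ⟨η, hη, h⟩ := PreAbstractSimplicialComplex.exists_injOn_of_injOn_join S ΘS hΘσ
      (k := k) (by rw [Fintype.card_fin]; omega) hω hinj
    rw [Fintype.card_fin] at h
    exact hnot (hS.isLefschetz_of_injOn hΘS hk.le hη h)
  constructor
  · rintro ⟨ω, hω, hbij⟩
    have h1 : (S.join (PreAbstractSimplicialComplex.simplexBoundary
        (Fin (S.rank - 2 * k)))).rank - 2 * (S.rank - k - 1) = 1 := by omega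
    rw [h1, pow_one] at hbij
    exact key ω hω hbij.injOn
  · rintro ⟨ω, hω, hinj, -⟩
    -- For rank `2j + 1` the injective range ends at `⌈d/2⌉ = j + 1`, that is, at multiplication out
    -- of degree `j`.
    exact key ω hω (hinj (S.rank - k - 1 + 1) (by omega) (by omega))
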